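/- Let $n\ge 1$, let $q$ be an indeterminate over $\mathbb C$, and put $\varepsilon=q-q^{-1}$. The affine Sergeev algebra $Se_n(q)$ is the associative unital $\mathbb C(q)$-algebra generated by elements $T_1,\dots,T_{n-1}$, $C_1,\dots,C_n$ and pairwise commuting invertible elements $X_1,\dots,X_n$, subject to the following relations, for all indices $k,l$ for which they make sense: $(T_k-q)(T_k+q^{-1})=0$, $\;T_kT_{k+1}T_k=T_{k+1}T_kT_{k+1}$, $\;T_kT_l=T_lT_k$ for $|k-l|>1$; $C_k^2=-1$, $\;C_kC_l=-C_lC_k$ for $l\ne k$; $T_kC_k=C_{k+1}T_k$, $\;T_kC_{k+1}=C_kT_k-\varepsilon\,(C_k-C_{k+1})$, $\;T_kC_l=C_lT_k$ for $l\ne k,k+1$; $T_kX_k=X_{k+1}T_k-\varepsilon\,(X_{k+1}-C_kC_{k+1}X_k)$, $\;T_kX_{k+1}=X_kT_k+\varepsilon\,(1+C_kC_{k+1})X_{k+1}$, $\;T_kX_l=X_lT_k$ for $l\ne k,k+1$; $C_kX_k=X_k^{-1}C_k$, $\;C_kX_l=X_lC_k$ for $l\ne k$. Let $\mathbb C(q)[X]=\mathbb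 C(q)[X_1^{\pm1},\dots,X_n^{\pm1}]$ denote the subalgebra of $Se_n(q)$ generated over $\mathbb C(q)$ by $X_1^{\pm1},\dots,X_n^{\pm1}$, that is, the space of Laurent polynomials in $X_1,\dots,X_n$. (a) The subalgebra $\mathbb C(q)[X]$ is maximal commutative: it is commutative and is not properly contained in any commutative subalgebra of $Se_n(q)$. (b) The centre of $Se_n(q)$ consists precisely of the symmetric polynomials, with coefficients in $\mathbb C(q)$, in the elements $X_k+X_k^{-1}$, $k=1,\dots,n$. -/

import Mathlib

noncomputable section

namespace AffineSergeev

open scoped IsMulCommutative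

/-- The field `ℂ(q)` of rational functions in the indeterminate `q`. -/
abbrev Cq : Type := RatFunc ℂ

/-- The indeterminate `q`. -/
def q : Cq := RatFunc.X

/-- `ε = q - q⁻¹`. -/
def ε : Cq := q - q⁻¹

/-- The generators of the affine Sergeev algebra: `T_1, …, T_{n-1}`, `C_1, …, C_n`,
`X_1, …, X_n` and the inverses of the `X_k`. Indices are shifted to start from `0`. -/
inductive Gen (n : ℕ) : Type
  | T (k : Fin (n - 1)) : Gen n
  | C (k : Fin n) : Gen n
  | X (k : Fin n) : Gen n
  | Xinv (k : Fin n) : Gen n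

/-- The index `k`, for `T_k`, as an index in `{1, …, n}`. -/
def lo {n : ℕ} (k : Fin (n - 1)) : Fin n := ⟨k, by omega⟩

/-- The index `k + 1`, for `T_k`, as an index in `{1, …, n}`. -/
def hi {n : ℕ} (k : Fin (n - 1)) : Fin n := ⟨k + 1, by omega⟩

/-- The generators in the free algebra over `ℂ(q)`. -/
abbrev fT {n : ℕ} (k : Fin (n - 1)) : FreeAlgebra Cq (Gen n) := FreeAlgebra.ι Cq (Gen.T k)
abbrev fC {n : ℕ} (k : Fin n) : FreeAlgebra Cq (Gen n) := FreeAlgebra.ι Cq (Gen.C k)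
abbrev fX {n : ℕ} (k : Fin n) : FreeAlgebra Cq (Gen n) := FreeAlgebra.ι Cq (Gen.X k)
abbrev fXinv {n : ℕ} (k : Fin n) : FreeAlgebra Cq (Gen n) := FreeAlgebra.ι Cq (Gen.Xinv k)

/-- A scalar in the free algebra. -/
abbrev fS {n : ℕ} (a : Cq) : FreeAlgebra Cq (Gen n) := algebraMap Cq _ a

/-- The defining relations of the affine Sergeev algebra `Se_n(q)`. -/
inductive Rel (n : ℕ) : FreeAlgebra Cq (Gen n) → FreeAlgebra Cq (Gen n) → Prop
  -- the Hecke algebra relations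
  | hecke_quad (k : Fin (n - 1)) : Rel n ((fT k - fS q) * (fT k + fS q⁻¹)) 0
  | hecke_braid (k l : Fin (n - 1)) (h : (l : ℕ) = k + 1) :
      Rel n (fT k * fT l * fT k) (fT l * fT k * fT l)
  | hecke_comm (k l : Fin (n - 1)) (h : (k : ℕ) + 1 < l) : Rel n (fT k * fT l) (fT l * fT k)
  -- the Clifford algebra relations
  | cliff_sq (k : Fin n) : Rel n (fC k * fC k) (-1)
  | cliff_anti (k l : Fin n) (h : l ≠ k) : Rel n (fC k * fC l) (-(fC l * fC k))
  -- the cross relations between the `T_k` and the `C_l`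
  | TC_lo (k : Fin (n - 1)) : Rel n (fT k * fC (lo k)) (fC (hi k) * fT k)
  | TC_hi (k : Fin (n - 1)) :
      Rel n (fT k * fC (hi k)) (fC (lo k) * fT k - fS ε * (fC (lo k) - fC (hi k)))
  | TC_far (k : Fin (n - 1)) (l : Fin n) (h₁ : l ≠ lo k) (h₂ : l ≠ hi k) :
      Rel n (fT k * fC l) (fC l * fT k)
  -- the `X_k` are invertible and commute pairwise
  | X_Xinv (k : Fin n) : Rel n (fX k * fXinv k) 1
  | Xinv_X (k : Fin n) : Rel n (fXinv k * fX k) 1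
  | X_comm (k l : Fin n) : Rel n (fX k * fX l) (fX l * fX k)
  -- the cross relations between the `T_k` and the `X_l`
  | TX_lo (k : Fin (n - 1)) :
      Rel n (fT k * fX (lo k))
        (fX (hi k) * fT k - fS ε * (fX (hi k) - fC (lo k) * fC (hi k) * fX (lo k)))
  | TX_hi (k : Fin (n - 1)) :
      Rel n (fT k * fX (hi k))
        (fX (lo k) * fT k + fS ε * (1 + fC (lo k) * fC (hi k)) * fX (hi k))
  | TX_far (k : Fin (n - 1)) (l : Fin n) (h₁ : l ≠ lo k) (h₂ : l ≠ hi k) :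
      Rel n (fT k * fX l) (fX l * fT k)
  -- the cross relations between the `C_k` and the `X_l`
  | CX_same (k : Fin n) : Rel n (fC k * fX k) (fXinv k * fC k)
  | CX_far (k l : Fin n) (h : l ≠ k) : Rel n (fC k * fX l) (fX l * fC k)

/-- The affine Sergeev algebra `Se_n(q)` over `ℂ(q)`. -/
abbrev Se (n : ℕ) : Type := RingQuot (Rel n)

/-- The image of a generator in `Se_n(q)`. -/
def gen {n : ℕ} (g : Gen n) : Se n := RingQuot.mkAlgHom Cq (Rel n) (FreeAlgebra.ι Cq g)

/-- The elements `X_1, …, X_n` of `Se_n(q)`, as units. -/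
def X {n : ℕ} (k : Fin n) : (Se n)ˣ where
  val := gen (Gen.X k)
  inv := gen (Gen.Xinv k)
  val_inv := by
    simpa [gen] using RingQuot.mkAlgHom_rel Cq (Rel.X_Xinv k)
  inv_val := by
    simpa [gen] using RingQuot.mkAlgHom_rel Cq (Rel.Xinv_X k)

theorem X_commute {n : ℕ} (k l : Fin n) : Commute (X k : Se n) (X l : Se n) := by
  show gen (Gen.X k) * gen (Gen.X l) = gen (Gen.X l) * gen (Gen.X k)
  simpa [gen] using RingQuot.mkAlgHom_rel Cq (Rel.X_comm k l)

/-- The elements `X_k` and `X_k⁻¹`. -/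
def laurentGens (n : ℕ) : Set (Se n) :=
  {x | ∃ k : Fin n, x = (X k : Se n) ∨ x = ((X k)⁻¹ : (Se n)ˣ)}

theorem laurentGens_comm (n : ℕ) :
    ∀ a ∈ laurentGens n, ∀ b ∈ laurentGens n, a * b = b * a := by
  rintro a ⟨k, rfl | rfl⟩ b ⟨l, rfl | rfl⟩
  · exact X_commute k l
  · exact (X_commute k l).units_inv_right
  · exact (X_commute k l).units_inv_left
  · exact (X_commute k l).units_inv_right.units_inv_left

/-- The subalgebra `ℂ(q)[X] = ℂ(q)[X_1^{±1}, …, X_n^{±1}]` of `Se_n(q)`. -/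
def laurent (n : ℕ) : Subalgebra Cq (Se n) := Algebra.adjoin Cq (laurentGens n)

instance laurent_isMulCommutative (n : ℕ) : IsMulCommutative (laurent n) :=
  Algebra.isMulCommutative_adjoin Cq (laurentGens_comm n)

/-- The element `X_k + X_k⁻¹` of `ℂ(q)[X]`. -/
def XaddInv {n : ℕ} (k : Fin n) : laurent n :=
  ⟨(X k : Se n) + ((X k)⁻¹ : (Se n)ˣ),
    add_mem (Algebra.subset_adjoin ⟨k, Or.inl rfl⟩) (Algebra.subset_adjoin ⟨k, Or.inr rfl⟩)⟩

/-- Evaluation of a polynomial in `n` commuting variables over `ℂ(q)` at the elements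
`X_1 + X_1⁻¹, …, X_n + X_n⁻¹` of `Se_n(q)`. -/
def evalXaddInv (n : ℕ) : MvPolynomial (Fin n) Cq →ₐ[Cq] Se n :=
  (laurent n).val.comp (MvPolynomial.aeval XaddInv)

/-- `A` is a maximal commutative subalgebra of `B`: it is commutative, and no strictly larger
subalgebra is. -/
def IsMaximalCommutative {K B : Type*} [CommRing K] [Ring B] [Algebra K B]
    (A : Subalgebra K B) : Prop :=
  Maximal (fun A' : Subalgebra K B => ∀ a ∈ A', ∀ b ∈ A', a * b = b * a) A

end AffineSergeev

end

/-! # Maximal commutativity of `ℂ(q)[X]` and the centre of the affine Sergeev algebra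

Everything rests on a Poincaré–Birkhoff–Witt theorem: each element of `Se_n(q)` is uniquely a sum of
terms `f C^S T_w`, with Laurent polynomials `f` in the `X_i`, Clifford monomials `C^S` and
permutations `w`. Uniqueness is obtained from explicit representations.

* Let `CL n` be the algebra generated by the `C_k` and `X_k^{±1}`. Its representation `CL.nor` on
  families of Laurent polynomials indexed by the `S` shows that the `f C^S` are independent.
* In `Se_n(q)`, moving `T_k` past `a` in `CL n` gives `s_k(a) T_k + d_k(a)` with an automorphism `s_k`
  and a twisted derivation `d_k`. Both exist on `CL n` because the triangular matrices with diagonal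
  `s_k(a)`, `a` and corner `d_k(a)` satisfy the relations of `CL n` for `a` running over the
  generators (`CliffordLaurent.tri`).
* Consequently `Se_n(q)` acts on the functions from permutations to `CL n` (`Reg.ρ`). The Hecke
  relations for these operators need to be checked on functions with scalar values only: there they
  are the relations in the regular representation of the finite Hecke algebra, and the differences
  of their two sides commute with the generators of `CL n` up to a permutation of the indices
  (`CrossRel.quad_mul_x`, `CrossRel.comm_mul`, `CrossRel.braid_mul`). Products along reduced words
  (`reducedProd`, well behaved by `reducedProd_of_desc`) then identify `Se_n(q)` with this module.

For (a), let `z` commute with all `X_i`, and let `w` be of maximal length among the permutations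
other than `1` that occur in `z`. Since `T_w X_i` is `X_{w(i)} T_w` up to terms with shorter
permutations, the coefficient `a` of `T_w` satisfies `X_i a = a X_{w(i)}` for all `i`. Comparing
exponents of Laurent monomials, this forces `a = 0`; so no such `w` exists. The same comparison
removes the `C^S` with `S ≠ 0`, and `z` is a Laurent polynomial.

For (b), a central element is a Laurent polynomial `f` by (a). Commuting with `C_k` makes `f`
invariant under `X_k ↦ X_k⁻¹`, and comparing the coefficients of `T_k` in `T_k f = f T_k` makes it
invariant under `s_k`. Averaging over the sign changes, and then over the permutations, writes such
an `f` as a symmetric polynomial in the `X_k + X_k⁻¹` (`Lau.exists_symmetric`). Conversely, all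
polynomials in the `X_k + X_k⁻¹` commute with the `C_k` and `X_k`, and moving `T_k` past one of them
produces its divided difference as a correction (`Se.t_mul_evalXaddInv`), which vanishes for symmetric
polynomials.
-/

noncomputable section

namespace AffineSergeev

open scoped IsMulCommutative

/-! ### Families satisfying the defining relations in an arbitrary algebra -/

theorem mul_reassoc {R : Type*} [Semigroup R] {a b e : R} (h : a * b = e) (z : R) :
    a * (b * z) = e * z := by rw [← mul_assoc, h]

section Families

variable {ι K R : Type*} [Field K] [Ring R] [Algebra K R]

/-- The relations between the `C_k`, the `X_k` and the inverses `Y_k` of the `X_k`, for families of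
elements of an arbitrary ring. -/
structure CliffordLaurent (c x y : ι → R) : Prop where
  c_sq (k : ι) : c k * c k = -1
  c_anti {k l : ι} (h : l ≠ k) : c k * c l = -(c l * c k)
  xy (k : ι) : x k * y k = 1
  yx (k : ι) : y k * x k = 1
  xx (k l : ι) : x k * x l = x l * x k
  cx_same (k : ι) : c k * x k = y k * c k
  cx_far {k l : ι} (h : l ≠ k) : c k * x l = x l * c k

namespace CliffordLaurent

variable {c x y : ι → R} (h : CliffordLaurent c x y)
include h

theorem map {S : Type*} [Ring S] [Algebra K S] (f : R →ₐ[K] S) :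
    CliffordLaurent (fun k => f (c k)) (fun k => f (x k)) (fun k => f (y k)) where
  c_sq k := by rw [← map_mul, h.c_sq, map_neg, map_one]
  c_anti hkl := by rw [← map_mul, h.c_anti hkl, map_neg, map_mul]
  xy k := by rw [← map_mul, h.xy, map_one]
  yx k := by rw [← map_mul, h.yx, map_one]
  xx k l := by rw [← map_mul, h.xx, map_mul]
  cx_same k := by rw [← map_mul, h.cx_same, map_mul]
  cx_far hkl := by rw [← map_mul, h.cx_far hkl, map_mul]

/-- `X_k` as a unit, with inverse `Y_k`. -/
def unit (k : ι) : Rˣ := ⟨x k, y k, h.xy k, h.yx k⟩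

theorem xy_comm (k l : ι) : x k * y l = y l * x k :=
  ((show Commute (x k) (h.unit l) from h.xx k l).units_inv_right : Commute _ _)

theorem yy (k l : ι) : y k * y l = y l * y k :=
  ((show Commute (h.unit k : R) (y l) from h.xy_comm k l).units_inv_left : Commute _ _)

theorem cy_same (k : ι) : c k * y k = x k * c k := by
  have := congrArg (fun z => x k * z * y k) (h.cx_same k)
  simpa [mul_assoc, h.xy, mul_reassoc (h.xy k)] using this.symm

theorem cy_far {k l : ι} (hkl : l ≠ k) : c k * y l = y l * c k :=
  ((show Commute (c k) (h.unit l) from h.cx_far hkl).units_inv_right : Commute _ _)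

end CliffordLaurent

/-- The relations between one `T_k` and the `C_l` and `X_l`; here `i` and `j` play the roles of
`k` and `k + 1`. -/
structure CrossRel (ε : K) (c x : ι → R) (t : R) (i j : ι) : Prop where
  tc_lo : t * c i = c j * t
  tc_hi : t * c j = c i * t - ε • (c i - c j)
  tc_far {l : ι} (h₁ : l ≠ i) (h₂ : l ≠ j) : t * c l = c l * t
  tx_lo : t * x i = x j * t - ε • (x j - c i * c j * x i)
  tx_hi : t * x j = x i * t + ε • ((1 + c i * c j) * x j)
  tx_far {l : ι} (h₁ : l ≠ i) (h₂ : l ≠ j) : t * x l = x l * t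

namespace CrossRel

variable {ε : K} {c x y : ι → R} {t : R} {i j : ι}

theorem ty_far (h : CliffordLaurent c x y) (r : CrossRel ε c x t i j) {l : ι} (h₁ : l ≠ i)
    (h₂ : l ≠ j) : t * y l = y l * t :=
  ((show Commute t (h.unit l) from r.tx_far h₁ h₂).units_inv_right : Commute _ _)

theorem ty_lo (h : CliffordLaurent c x y) (r : CrossRel ε c x t i j) :
    t * y i = y j * t + ε • (y i - y j * c i * c j) := by
  have := congrArg (fun z => y j * z * y i) r.tx_lo
  simp only [mul_sub, sub_mul, mul_smul_comm, smul_mul_assoc, mul_assoc, h.xy, mul_one, one_mul,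
    mul_reassoc (h.yx j), smul_sub] at this ⊢
  rw [this]
  abel

theorem ty_hi (h : CliffordLaurent c x y) (r : CrossRel ε c x t i j) :
    t * y j = y i * t - ε • (y i * (1 + c i * c j)) := by
  have := congrArg (fun z => y i * z * y j) r.tx_hi
  simp only [mul_add, add_mul, mul_smul_comm, smul_mul_assoc, mul_assoc, h.xy, mul_one, one_mul,
    mul_reassoc (h.yx i), smul_add] at this ⊢
  rw [this]
  abel

/-- The cross relations alone, without a quadratic relation for `T`, imply that `T² - ε T - 1`
commutes with the `C_l`. With `quad_mul_x`, this is how the quadratic relation will be checked for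
operators: it has to be verified on generators of the module only. -/
theorem quad_mul_c (r : CrossRel ε c x t i j) (l : ι) :
    (t * t - ε • t - 1) * c l = c l * (t * t - ε • t - 1) := by
  by_cases h₁ : l = i
  · subst h₁
    simp only [mul_sub, sub_mul, mul_assoc, smul_mul_assoc, mul_smul_comm, mul_one, one_mul,
      smul_sub, r.tc_lo, mul_reassoc r.tc_hi]
    module
  by_cases h₂ : l = j
  · subst h₂
    simp only [mul_sub, sub_mul, mul_assoc, smul_mul_assoc, mul_smul_comm, mul_one, one_mul,
      smul_sub, r.tc_lo, r.tc_hi, mul_reassoc r.tc_lo]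
    module
  · simp only [mul_sub, sub_mul, mul_assoc, smul_mul_assoc, mul_smul_comm, mul_one, one_mul,
      r.tc_far h₁ h₂, mul_reassoc (r.tc_far h₁ h₂)]

theorem quad_mul_x (h : CliffordLaurent c x y) (r : CrossRel ε c x t i j)
    (hij : i ≠ j) (l : ι) :
    (t * t - ε • t - 1) * x l = x l * (t * t - ε • t - 1) := by
  have c21 := h.c_anti hij
  have e₁ := h.cx_far hij
  have e₄ := h.cy_far hij.symm
  by_cases h₁ : l = i
  · subst h₁
    simp only [add_mul, mul_sub, sub_mul, mul_assoc, smul_mul_assoc, mul_smul_comm, mul_one,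
      one_mul, smul_sub, smul_add, r.tc_hi, mul_reassoc r.tc_lo, r.tx_lo, r.tx_hi,
      mul_reassoc r.tx_hi, c21, mul_reassoc c21, e₁, mul_reassoc e₄, h.cx_same, mul_reassoc (h.cx_same _),
      h.c_sq, neg_mul, mul_neg, smul_neg, mul_reassoc (r.ty_lo h)]
    module
  by_cases h₂ : l = j
  · subst h₂
    simp only [mul_add, add_mul, mul_sub, sub_mul, mul_assoc, smul_mul_assoc, mul_smul_comm,
      mul_one, one_mul, smul_sub, smul_add, r.tc_hi, mul_reassoc r.tc_lo, r.tx_hi,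
      mul_reassoc r.tx_lo, c21, mul_reassoc c21, e₁, mul_reassoc e₄, h.cx_same, mul_reassoc (h.cx_same _),
      h.c_sq, neg_mul, mul_neg, smul_neg, mul_reassoc (r.ty_hi h)]
    module
  · simp only [mul_sub, sub_mul, mul_assoc, smul_mul_assoc, mul_smul_comm, mul_one, one_mul,
      r.tx_far h₁ h₂, mul_reassoc (r.tx_far h₁ h₂)]

variable {u : R} {k : ι}

/-- The cross relations alone imply that the commutator of two distant `T_k` commutes with the `C_m`
and `X_m` up to a permutation of the indices. -/
theorem comm_mul (r : CrossRel ε c x t i j) {k l : ι} (s : CrossRel ε c x u k l)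
    (hik : i ≠ k) (hil : i ≠ l) (hjk : j ≠ k) (hjl : j ≠ l) (m : ι) :
    (∃ m', (t * u - u * t) * c m = c m' * (t * u - u * t)) ∧
    ∃ m', (t * u - u * t) * x m = x m' * (t * u - u * t) := by
  have e₁ := s.tc_far hik hil
  have e₂ := s.tc_far hjk hjl
  have e₃ := r.tc_far hik.symm hjk.symm
  have e₄ := r.tc_far hil.symm hjl.symm
  have e₅ := s.tx_far hik hil
  have e₆ := s.tx_far hjk hjl
  have e₇ := r.tx_far hik.symm hjk.symm
  have e₈ := r.tx_far hil.symm hjl.symm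
  have key : ∀ m m', ((t * u - u * t) * c m = c m' * (t * u - u * t) ∧
      (t * u - u * t) * x m = x m' * (t * u - u * t)) →
      (∃ m', (t * u - u * t) * c m = c m' * (t * u - u * t)) ∧
      ∃ m', (t * u - u * t) * x m = x m' * (t * u - u * t) :=
    fun m m' h => ⟨⟨m', h.1⟩, ⟨m', h.2⟩⟩
  by_cases h₁ : m = i
  · subst h₁
    refine key _ j ⟨?_, ?_⟩ <;>
    · simp only [mul_sub, sub_mul, mul_assoc, e₁, e₅, e₆, mul_reassoc e₁, mul_reassoc e₂,
        mul_reassoc e₆, r.tc_lo, mul_reassoc r.tc_lo, r.tx_lo, mul_reassoc r.tx_lo, smul_mul_assoc,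
        mul_smul_comm, smul_sub]
      try module
  by_cases h₂ : m = j
  · subst h₂
    refine key _ i ⟨?_, ?_⟩ <;>
    · simp only [mul_sub, sub_mul, mul_assoc, e₁, e₂, e₆, mul_reassoc e₁, mul_reassoc e₂,
        mul_reassoc e₅, r.tc_hi, mul_reassoc r.tc_hi, r.tx_hi, mul_reassoc r.tx_hi, smul_mul_assoc,
        mul_smul_comm, smul_sub, mul_add, add_mul, one_mul]
      module
  have f₁ := r.tc_far h₁ h₂
  have f₂ := r.tx_far h₁ h₂
  by_cases h₃ : m = k
  · subst h₃
    refine key _ l ⟨?_, ?_⟩ <;>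
    · simp only [mul_sub, sub_mul, mul_assoc, e₃, e₇, e₈, mul_reassoc e₃, mul_reassoc e₄,
        mul_reassoc e₈, s.tc_lo, mul_reassoc s.tc_lo, s.tx_lo, mul_reassoc s.tx_lo, smul_mul_assoc,
        mul_smul_comm, smul_sub]
      try module
  by_cases h₄ : m = l
  · subst h₄
    refine key _ k ⟨?_, ?_⟩ <;>
    · simp only [mul_sub, sub_mul, mul_assoc, e₃, e₄, e₈, mul_reassoc e₃, mul_reassoc e₄,
        mul_reassoc e₇, s.tc_hi, mul_reassoc s.tc_hi, s.tx_hi, mul_reassoc s.tx_hi, smul_mul_assoc,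
        mul_smul_comm, smul_sub, mul_add, add_mul, one_mul]
      module
  have f₃ := s.tc_far h₃ h₄
  have f₄ := s.tx_far h₃ h₄
  refine key _ m ⟨?_, ?_⟩ <;>
    simp only [mul_sub, sub_mul, mul_assoc, f₁, f₂, f₃, f₄, mul_reassoc f₁, mul_reassoc f₂,
      mul_reassoc f₃, mul_reassoc f₄]

/-- The cross and quadratic relations imply that the difference `T_k T_{k+1} T_k - T_{k+1} T_k T_{k+1}`
commutes with the `C_m` and `X_m` up to a permutation of the indices. -/
theorem braid_mul (h : CliffordLaurent c x y) (r : CrossRel ε c x t i j) (s : CrossRel ε c x u j k)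
    (hij : i ≠ j) (hik : i ≠ k) (hjk : j ≠ k) (tt : t * t = ε • t + 1) (uu : u * u = ε • u + 1)
    (m : ι) :
    (∃ m', (t * u * t - u * t * u) * c m = c m' * (t * u * t - u * t * u)) ∧
    ∃ m', (t * u * t - u * t * u) * x m = x m' * (t * u * t - u * t * u) := by
  have key : ∀ m m', ((t * u * t - u * t * u) * c m = c m' * (t * u * t - u * t * u) ∧
      (t * u * t - u * t * u) * x m = x m' * (t * u * t - u * t * u)) →
      (∃ m', (t * u * t - u * t * u) * c m = c m' * (t * u * t - u * t * u)) ∧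
      ∃ m', (t * u * t - u * t * u) * x m = x m' * (t * u * t - u * t * u) :=
    fun m m' h => ⟨⟨m', h.1⟩, ⟨m', h.2⟩⟩
  by_cases hm : m ≠ i ∧ m ≠ j ∧ m ≠ k
  · obtain ⟨h₁, h₂, h₃⟩ := hm
    have f₁ := r.tc_far h₁ h₂
    have f₂ := r.tx_far h₁ h₂
    have f₃ := s.tc_far h₂ h₃
    have f₄ := s.tx_far h₂ h₃
    refine key _ m ⟨?_, ?_⟩ <;>
      simp only [mul_sub, sub_mul, mul_assoc, f₁, f₂, f₃, f₄, mul_reassoc f₁, mul_reassoc f₂,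
        mul_reassoc f₃, mul_reassoc f₄]
  have c21 := h.c_anti hij
  have c31 := h.c_anti hik
  have c32 := h.c_anti hjk
  have c11 := h.c_sq i
  have c22 := h.c_sq j
  have c33 := h.c_sq k
  have a₁ := h.cx_same i
  have a₂ := h.cx_same j
  have a₃ := h.cx_same k
  have b₁ := h.cx_far hij
  have b₃ := h.cx_far hjk
  have d₄ := h.cy_far hij.symm
  have d₆ := h.cy_far hjk.symm
  have tc1 := r.tc_lo
  have tc2 := r.tc_hi
  have tc3 := r.tc_far hik.symm hjk.symm
  have tx1 := r.tx_lo
  have tx2 := r.tx_hi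
  have tx3 := r.tx_far hik.symm hjk.symm
  have ty1 := r.ty_lo h
  have ty2 := r.ty_hi h
  have ty3 := r.ty_far h hik.symm hjk.symm
  have uc1 := s.tc_far hij hik
  have uc2 := s.tc_lo
  have uc3 := s.tc_hi
  have ux1 := s.tx_far hij hik
  have ux2 := s.tx_lo
  have ux3 := s.tx_hi
  have uy1 := s.ty_far h hij hik
  have uy2 := s.ty_lo h
  have uy3 := s.ty_hi h
  obtain ⟨m', hm'⟩ : ∃ m', (m = i ∧ m' = k) ∨ (m = j ∧ m' = j) ∨ (m = k ∧ m' = i) := by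
    by_cases h₁ : m = i
    · exact ⟨k, .inl ⟨h₁, rfl⟩⟩
    by_cases h₂ : m = j
    · exact ⟨j, .inr (.inl ⟨h₂, rfl⟩)⟩
    · exact ⟨i, .inr (.inr ⟨by tauto, rfl⟩)⟩
  refine key m m' ?_
  -- Rewriting with the rules above moves the `t` and `u` to the right of the `c`, `x` and `y`; the
  -- resulting normal forms agree.
  rcases hm' with ⟨rfl, rfl⟩ | ⟨rfl, rfl⟩ | ⟨rfl, rfl⟩ <;> constructor <;>
  · simp only [mul_add, add_mul, mul_sub, sub_mul, mul_assoc, smul_mul_assoc, mul_smul_comm,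
      mul_one, one_mul, neg_mul, mul_neg, smul_add, smul_sub, smul_neg, smul_smul, tt, uu, c11, c22,
      c33, c21, c32, a₂, a₃, b₁, b₃, tc1, tc2, tc3, uc1, uc2, uc3, tx1, tx2, tx3, ux1, ux2, ux3,
      mul_reassoc c11, mul_reassoc c22, mul_reassoc c33, mul_reassoc c21, mul_reassoc c31,
      mul_reassoc c32, mul_reassoc a₁, mul_reassoc a₂, mul_reassoc d₄, mul_reassoc d₆,
      mul_reassoc tc1, mul_reassoc tc2, mul_reassoc tc3, mul_reassoc uc1, mul_reassoc uc2,
      mul_reassoc uc3, mul_reassoc tx1, mul_reassoc tx2, mul_reassoc tx3, mul_reassoc ux1, mul_reassoc ux2,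
      mul_reassoc ux3, mul_reassoc ty1, mul_reassoc ty2, mul_reassoc ty3, mul_reassoc uy1,
      mul_reassoc uy2, mul_reassoc uy3]
    try module

end CrossRel

/-! ### Triangular matrices and twisted derivations -/

/-- The upper triangular matrix with rows `(a, b)` and `(0, d)`. -/
def tri (a b d : R) : Matrix (Fin 2) (Fin 2) R := !![a, b; 0, d]

theorem tri_mul (a b d a' b' d' : R) :
    tri a b d * tri a' b' d' = tri (a * a') (a * b' + b * d') (d * d') := by
  simp [tri]

theorem tri_neg (a b d : R) : -tri a b d = tri (-a) (-b) (-d) := by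
  simp [tri]

theorem tri_one : (1 : Matrix (Fin 2) (Fin 2) R) = tri 1 0 1 := by
  simp [tri, Matrix.one_fin_two]

theorem tri_congr {a b d a' b' d' : R} (ha : a = a') (hb : b = b') (hd : d = d') :
    tri a b d = tri a' b' d' := by rw [ha, hb, hd]

section Twist

variable [DecidableEq ι] (ε : K) (c x y : ι → R) (i j : ι)

/-- The correction term in `T_k C_l = C_{s_k l} T_k + …`, with `i`, `j` in the roles of `k`,
`k + 1`. -/
def dC (l : ι) : R := if l = j then -(ε • (c i - c j)) else 0

/-- The correction term in `T_k X_l = X_{s_k l} T_k + …`. -/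
def dX (l : ι) : R :=
  if l = i then -(ε • (x j - c i * c j * x i)) else
    if l = j then ε • ((1 + c i * c j) * x j) else 0

/-- The correction term in `T_k X_l⁻¹ = X_{s_k l}⁻¹ T_k + …`. -/
def dY (l : ι) : R :=
  if l = i then ε • (y i - y j * c i * c j) else
    if l = j then -(ε • (y i * (1 + c i * c j))) else 0

/-- The triangular matrices whose diagonal entries are `C_{s_k l}`, `C_l` and whose corner is the
correction term. -/
def triC (l : ι) : Matrix (Fin 2) (Fin 2) R := tri (c (Equiv.swap i j l)) (dC ε c i j l) (c l)

/-- The analogue of `triC` for `X_l`. -/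
def triX (l : ι) : Matrix (Fin 2) (Fin 2) R := tri (x (Equiv.swap i j l)) (dX ε c x i j l) (x l)

/-- The analogue of `triC` for `X_l⁻¹`. -/
def triY (l : ι) : Matrix (Fin 2) (Fin 2) R := tri (y (Equiv.swap i j l)) (dY ε c y i j l) (y l)

variable {c x y i j}

theorem dC_of_ne {l : ι} (h : l ≠ j) : dC ε c i j l = 0 := if_neg h

theorem dC_hi : dC ε c i j j = -(ε • (c i - c j)) := if_pos rfl

theorem dX_of_ne {l : ι} (h : l ≠ i) (h' : l ≠ j) : dX ε c x i j l = 0 := by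
  rw [dX, if_neg h, if_neg h']

theorem dX_lo : dX ε c x i j i = -(ε • (x j - c i * c j * x i)) := if_pos rfl

theorem dX_hi (h : i ≠ j) : dX ε c x i j j = ε • ((1 + c i * c j) * x j) := by
  rw [dX, if_neg h.symm, if_pos rfl]

theorem dY_of_ne {l : ι} (h : l ≠ i) (h' : l ≠ j) : dY ε c y i j l = 0 := by
  rw [dY, if_neg h, if_neg h']

theorem dY_lo : dY ε c y i j i = ε • (y i - y j * c i * c j) := if_pos rfl

theorem dY_hi (h : i ≠ j) : dY ε c y i j j = -(ε • (y i * (1 + c i * c j))) := by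
  rw [dY, if_neg h.symm, if_pos rfl]

/-- The triangular matrices satisfy the relations between the `C_k` and the `X_k`. By the universal
property, the corrections on the generators therefore extend to a twisted derivation. -/
theorem CliffordLaurent.tri (h : CliffordLaurent c x y) (hij : i ≠ j) :
    CliffordLaurent (triC ε c i j) (triX ε c x i j) (triY ε c y i j) := by
  have c21 := h.c_anti hij
  have c11 := h.c_sq i
  have c22 := h.c_sq j
  have a₁ := h.cx_same i
  have a₂ := h.cx_same j
  have a₄ := h.cy_same i
  have a₅ := h.cy_same j
  have b₁ := h.cx_far hij
  have b₄ := h.cx_far hij.symm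
  have d₁ := h.cy_far hij
  have d₄ := h.cy_far hij.symm
  have x₁ := h.xx j i
  have x₂ := h.xy i
  have x₃ := h.xy j
  have x₄ := h.yx i
  have x₅ := h.yx j
  have x₇ := (h.xy_comm j i).symm
  have x₈ := h.yy j i
  have cases : ∀ l, l = i ∨ l = j ∨ (l ≠ i ∧ l ≠ j) := fun l => by tauto
  have f₁ : ∀ l, l ≠ i → l ≠ j → c l * c i = -(c i * c l) := fun l hl _ => h.c_anti hl.symm
  have f₂ : ∀ l, l ≠ i → l ≠ j → c l * c j = -(c j * c l) := fun l _ hl => h.c_anti hl.symm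
  have f₄ : ∀ l, l ≠ i → l ≠ j → c l * x j = x j * c l := fun l _ hl => h.cx_far hl.symm
  have f₅ : ∀ l, l ≠ i → l ≠ j → c i * x l = x l * c i := fun l hl _ => h.cx_far hl
  have f₆ : ∀ l, l ≠ i → l ≠ j → c j * x l = x l * c j := fun l _ hl => h.cx_far hl
  have f₈ : ∀ l, l ≠ i → l ≠ j → x l * x j = x j * x l := fun l _ _ => h.xx l j
  have f₉ : ∀ l, l ≠ i → l ≠ j → c l * y i = y i * c l := fun l hl _ => h.cy_far hl.symm
  have f₀ : ∀ l, l ≠ i → l ≠ j → c l * y j = y j * c l := fun l _ hl => h.cy_far hl.symm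
  have r₁ := fun l hl hl' => mul_reassoc (f₁ l hl hl')
  have r₅ := fun l hl hl' => mul_reassoc (f₅ l hl hl')
  have r₉ := fun l hl hl' => mul_reassoc (f₉ l hl hl')
  have r₀ := fun l hl hl' => mul_reassoc (f₀ l hl hl')
  have g₁ : ∀ l, l ≠ i → l ≠ j → x l * y i = y i * x l := fun l _ _ => h.xy_comm l i
  have g₂ : ∀ l, l ≠ i → l ≠ j → x l * y j = y j * x l := fun l _ _ => h.xy_comm l j
  have g₃ := fun l hl hl' => mul_reassoc (g₁ l hl hl')
  have g₄ := fun l hl hl' => mul_reassoc (g₂ l hl hl')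
  constructor
  case' c_sq =>
    intro l
    rw [triC, tri_mul, tri_one, tri_neg]
    refine tri_congr (h.c_sq _) ?_ (h.c_sq _)
    rcases cases l with rfl | rfl | ⟨hl, hl'⟩
  case' c_anti =>
    intro l m hlm
    rw [triC, triC, tri_mul, tri_mul, tri_neg]
    refine tri_congr (h.c_anti ((Equiv.injective _).ne hlm)) ?_ (h.c_anti hlm)
    rcases cases l with rfl | rfl | ⟨hl, hl'⟩ <;> rcases cases m with rfl | rfl | ⟨hm, hm'⟩
    all_goals try exact absurd rfl hlm
  case' xy =>
    intro l
    rw [triX, triY, tri_mul, tri_one]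
    refine tri_congr (h.xy _) ?_ (h.xy _)
    rcases cases l with rfl | rfl | ⟨hl, hl'⟩
  case' yx =>
    intro l
    rw [triX, triY, tri_mul, tri_one]
    refine tri_congr (h.yx _) ?_ (h.yx _)
    rcases cases l with rfl | rfl | ⟨hl, hl'⟩
  case' xx =>
    intro l m
    rw [triX, triX, tri_mul, tri_mul]
    refine tri_congr (h.xx _ _) ?_ (h.xx _ _)
    rcases cases l with rfl | rfl | ⟨hl, hl'⟩ <;> rcases cases m with rfl | rfl | ⟨hm, hm'⟩
  case' cx_same =>
    intro l
    rw [triC, triX, triY, tri_mul, tri_mul]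
    refine tri_congr (h.cx_same _) ?_ (h.cx_same _)
    rcases cases l with rfl | rfl | ⟨hl, hl'⟩
  case' cx_far =>
    intro l m hlm
    rw [triC, triX, tri_mul, tri_mul]
    refine tri_congr (h.cx_far ((Equiv.injective _).ne hlm)) ?_ (h.cx_far hlm)
    rcases cases l with rfl | rfl | ⟨hl, hl'⟩ <;> rcases cases m with rfl | rfl | ⟨hm, hm'⟩
    all_goals try exact absurd rfl hlm
  -- Only the corner entries are left; the rules above bring both sides to the same normal form.
  all_goals
    simp (disch := assumption) only [dC_of_ne, dC_hi, dX_lo, dX_hi, dX_of_ne, dY_lo, dY_hi,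
      dY_of_ne, Equiv.swap_apply_right, Equiv.swap_apply_left, Equiv.swap_apply_of_ne_of_ne,
      mul_sub, sub_mul, mul_add, add_mul, mul_assoc, mul_neg, neg_mul, neg_neg, smul_mul_assoc,
      mul_smul_comm, smul_add, smul_sub, smul_neg, mul_zero, zero_mul, mul_one, one_mul, add_zero,
      zero_add, neg_zero, c21, c11, c22, a₁, a₂, a₅, b₁, b₄, d₁, x₁, x₂, x₃, x₄, x₅, x₇,
      mul_reassoc c21, mul_reassoc c11, mul_reassoc a₁, mul_reassoc a₄, mul_reassoc a₅,
      mul_reassoc b₄, mul_reassoc d₁, mul_reassoc d₄, mul_reassoc x₂, mul_reassoc x₃, mul_reassoc x₄,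
      mul_reassoc x₅, mul_reassoc x₈, f₁, f₂, f₄, f₅, f₆, f₈, r₁, r₅, r₉, r₀, g₃, g₄]
    try module

end Twist
end Families

/-! ### The subalgebra without the `T_k`, given by generators and relations -/

/-- The generators `C_k`, `X_k`, `X_k⁻¹`. -/
inductive CLGen (n : ℕ) : Type
  | C (k : Fin n) : CLGen n
  | X (k : Fin n) : CLGen n
  | Xinv (k : Fin n) : CLGen n

/-- The relations of `Se_n(q)` that do not involve the `T_k`. -/
inductive CLRel (n : ℕ) : FreeAlgebra Cq (CLGen n) → FreeAlgebra Cq (CLGen n) → Prop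
  | c_sq (k : Fin n) : CLRel n (FreeAlgebra.ι Cq (.C k) * FreeAlgebra.ι Cq (.C k)) (-1)
  | c_anti (k l : Fin n) (h : l ≠ k) :
      CLRel n (FreeAlgebra.ι Cq (.C k) * FreeAlgebra.ι Cq (.C l))
        (-(FreeAlgebra.ι Cq (.C l) * FreeAlgebra.ι Cq (.C k)))
  | xy (k : Fin n) : CLRel n (FreeAlgebra.ι Cq (.X k) * FreeAlgebra.ι Cq (.Xinv k)) 1
  | yx (k : Fin n) : CLRel n (FreeAlgebra.ι Cq (.Xinv k) * FreeAlgebra.ι Cq (.X k)) 1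
  | xx (k l : Fin n) :
      CLRel n (FreeAlgebra.ι Cq (.X k) * FreeAlgebra.ι Cq (.X l))
        (FreeAlgebra.ι Cq (.X l) * FreeAlgebra.ι Cq (.X k))
  | cx_same (k : Fin n) :
      CLRel n (FreeAlgebra.ι Cq (.C k) * FreeAlgebra.ι Cq (.X k))
        (FreeAlgebra.ι Cq (.Xinv k) * FreeAlgebra.ι Cq (.C k))
  | cx_far (k l : Fin n) (h : l ≠ k) :
      CLRel n (FreeAlgebra.ι Cq (.C k) * FreeAlgebra.ι Cq (.X l))
        (FreeAlgebra.ι Cq (.X l) * FreeAlgebra.ι Cq (.C k))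

/-- The algebra with generators `C_k`, `X_k^{±1}` and the relations of `Se_n(q)` between them. It
turns out to be a subalgebra of `Se_n(q)`. -/
def CL (n : ℕ) : Type := RingQuot (CLRel n)

namespace CL

instance (n : ℕ) : Ring (CL n) := inferInstanceAs (Ring (RingQuot (CLRel n)))

instance (n : ℕ) : Algebra Cq (CL n) := inferInstanceAs (Algebra Cq (RingQuot (CLRel n)))

/-- The quotient map from the free algebra to `CL n`. -/
def mk (n : ℕ) : FreeAlgebra Cq (CLGen n) →ₐ[Cq] CL n := RingQuot.mkAlgHom Cq (CLRel n)

theorem mk_surjective (n : ℕ) : Function.Surjective (mk n) :=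
  RingQuot.mkAlgHom_surjective Cq (CLRel n)

theorem mk_rel {n : ℕ} {a b : FreeAlgebra Cq (CLGen n)} (h : CLRel n a b) : mk n a = mk n b :=
  RingQuot.mkAlgHom_rel Cq h

/-- A generator, as an element of `CL n`. -/
def gen (g : CLGen n) : CL n := mk n (FreeAlgebra.ι Cq g)

/-- The generators `C_k` of `CL n`. -/
def c (k : Fin n) : CL n := gen (.C k)
/-- The generators `X_k` of `CL n`. -/
def x (k : Fin n) : CL n := gen (.X k)
/-- The generators `X_k⁻¹` of `CL n`. -/
def y (k : Fin n) : CL n := gen (.Xinv k)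

theorem rel (n : ℕ) : CliffordLaurent (c (n := n)) x y where
  c_sq k := by simpa [c, gen] using mk_rel (CLRel.c_sq k)
  c_anti h := by simpa [c, gen] using mk_rel (CLRel.c_anti _ _ h)
  xy k := by simpa [x, y, gen] using mk_rel (CLRel.xy k)
  yx k := by simpa [x, y, gen] using mk_rel (CLRel.yx k)
  xx k l := by simpa [x, gen] using mk_rel (CLRel.xx k l)
  cx_same k := by simpa [c, x, y, gen] using mk_rel (CLRel.cx_same k)
  cx_far h := by simpa [c, x, gen] using mk_rel (CLRel.cx_far _ _ h)

section Lift

variable {R : Type*} [Ring R] [Algebra Cq R] {c' x' y' : Fin n → R}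

/-- The values of the lifted homomorphism on the generators. -/
def liftGen (c' x' y' : Fin n → R) : CLGen n → R
  | .C k => c' k
  | .X k => x' k
  | .Xinv k => y' k

/-- The universal property of `CL n`. -/
def lift (h : CliffordLaurent c' x' y') : CL n →ₐ[Cq] R :=
  RingQuot.liftAlgHom Cq ⟨FreeAlgebra.lift Cq (liftGen c' x' y'), by
    rintro _ _ (k | ⟨k, l, hkl⟩ | k | k | ⟨k, l⟩ | k | ⟨k, l, hkl⟩)
    · simpa [liftGen] using h.c_sq k
    · simpa [liftGen] using h.c_anti hkl
    · simpa [liftGen] using h.xy k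
    · simpa [liftGen] using h.yx k
    · simpa [liftGen] using h.xx k l
    · simpa [liftGen] using h.cx_same k
    · simpa [liftGen] using h.cx_far hkl⟩

variable (h : CliffordLaurent c' x' y') (k : Fin n)

theorem lift_mk (a : FreeAlgebra Cq (CLGen n)) :
    lift h (mk n a) = FreeAlgebra.lift Cq (liftGen c' x' y') a :=
  RingQuot.liftAlgHom_mkAlgHom_apply Cq ..

@[simp] theorem lift_c : lift h (c k) = c' k := by simp [c, gen, liftGen, lift_mk]
@[simp] theorem lift_x : lift h (x k) = x' k := by simp [x, gen, liftGen, lift_mk]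
@[simp] theorem lift_y : lift h (y k) = y' k := by simp [y, gen, liftGen, lift_mk]

theorem algHom_ext {f g : CL n →ₐ[Cq] R} (hc : ∀ k, f (c k) = g (c k))
    (hx : ∀ k, f (x k) = g (x k)) (hy : ∀ k, f (y k) = g (y k)) : f = g := by
  have key : f.comp (mk n) = g.comp (mk n) := by
    apply FreeAlgebra.hom_ext
    funext g
    rcases g with k | k | k
    exacts [hc k, hx k, hy k]
  ext a
  obtain ⟨b, rfl⟩ := mk_surjective n a
  exact DFunLike.congr_fun key b

end Lift

theorem eq_top_of_mem (S : Subalgebra Cq (CL n)) (hc : ∀ k, c k ∈ S) (hx : ∀ k, x k ∈ S)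
    (hy : ∀ k, y k ∈ S) (a : CL n) : a ∈ S := by
  obtain ⟨b, rfl⟩ := mk_surjective n a
  induction b using FreeAlgebra.induction with
  | grade0 r => simp
  | grade1 g =>
    rcases g with k | k | k
    exacts [hc k, hx k, hy k]
  | mul a b ha hb => rw [map_mul]; exact mul_mem ha hb
  | add a b ha hb => rw [map_add]; exact add_mem ha hb

@[elab_as_elim]
theorem induction {P : CL n → Prop} (a : CL n) (hr : ∀ r : Cq, P (algebraMap Cq _ r))
    (hc : ∀ k, P (c k)) (hx : ∀ k, P (x k)) (hy : ∀ k, P (y k))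
    (hadd : ∀ a b, P a → P b → P (a + b)) (hmul : ∀ a b, P a → P b → P (a * b)) : P a :=
  eq_top_of_mem
    { carrier := {a | P a}, mul_mem' := fun ha hb => hmul _ _ ha hb,
      add_mem' := fun ha hb => hadd _ _ ha hb, algebraMap_mem' := hr } hc hx hy a

/-! ### The twisted derivations of the subalgebra without the `T_k` -/

theorem lo_ne_hi (k : Fin (n - 1)) : lo k ≠ hi k := by simp [lo, hi, Fin.ext_iff]

/-- The homomorphism to triangular matrices that encodes an automorphism of `CL n` and a
twisted derivation. -/
def twist (k : Fin (n - 1)) : CL n →ₐ[Cq] Matrix (Fin 2) (Fin 2) (CL n) :=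
  lift ((rel n).tri ε (lo_ne_hi k))

/-- The automorphism of `CL n` that interchanges the indices `k` and `k + 1`. -/
def s (k : Fin (n - 1)) : CL n →ₗ[Cq] CL n :=
  Matrix.entryLinearMap Cq (CL n) 0 0 ∘ₗ (twist k).toLinearMap

/-- The twisted derivation of `CL n` such that `T_k a = s_k(a) T_k + d_k(a)`. -/
def d (k : Fin (n - 1)) : CL n →ₗ[Cq] CL n :=
  Matrix.entryLinearMap Cq (CL n) 0 1 ∘ₗ (twist k).toLinearMap

theorem twist_eq (k : Fin (n - 1)) (a : CL n) : twist k a = tri (s k a) (d k a) a := by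
  suffices h : twist k a 1 0 = 0 ∧ twist k a 1 1 = a by
    ext i j
    fin_cases i <;> fin_cases j <;> simp [tri, s, d, h.1, h.2]
  induction a using CL.induction with
  | hr r => simp [Matrix.algebraMap_matrix_apply]
  | hc l => simp [twist, triC, tri]
  | hx l => simp [twist, triX, tri]
  | hy l => simp [twist, triY, tri]
  | hadd a b ha hb => simp [ha, hb]
  | hmul a b ha hb => simp [Matrix.mul_apply, ha, hb]

variable (k : Fin (n - 1))

theorem s_algebraMap (r : Cq) : s k (algebraMap Cq (CL n) r) = algebraMap Cq (CL n) r := by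
  simp [s, Matrix.algebraMap_matrix_apply]

theorem d_algebraMap (r : Cq) : d k (algebraMap Cq (CL n) r) = 0 := by
  simp [d, Matrix.algebraMap_matrix_apply]

theorem s_mul (a b : CL n) : s k (a * b) = s k a * s k b := by
  have : s k (a * b) = (twist k (a * b)) 0 0 := rfl
  rw [this, map_mul, twist_eq, twist_eq, tri_mul]
  simp [tri]

theorem d_mul (a b : CL n) : d k (a * b) = s k a * d k b + d k a * b := by
  have : d k (a * b) = (twist k (a * b)) 0 1 := rfl
  rw [this, map_mul, twist_eq, twist_eq, tri_mul]
  simp [tri]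

theorem s_one : s k (1 : CL n) = 1 := by simpa using s_algebraMap k 1
theorem d_one : d k (1 : CL n) = 0 := by simpa using d_algebraMap k 1

theorem s_c (l : Fin n) : s k (c l) = c (Equiv.swap (lo k) (hi k) l) := by
  simp [s, twist, triC, tri]
theorem s_x (l : Fin n) : s k (x l) = x (Equiv.swap (lo k) (hi k) l) := by
  simp [s, twist, triX, tri]
theorem s_y (l : Fin n) : s k (y l) = y (Equiv.swap (lo k) (hi k) l) := by
  simp [s, twist, triY, tri]
theorem d_c (l : Fin n) : d k (c l) = dC ε c (lo k) (hi k) l := by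
  simp [d, twist, triC, tri]
theorem d_x (l : Fin n) : d k (x l) = dX ε c x (lo k) (hi k) l := by
  simp [d, twist, triX, tri]
theorem d_y (l : Fin n) : d k (y l) = dY ε c y (lo k) (hi k) l := by
  simp [d, twist, triY, tri]

end CL

/-! ### Relations and universal property of the affine Sergeev algebra -/

namespace Se

/-- The image of `T_k` in `Se_n(q)`. -/
abbrev t (k : Fin (n - 1)) : Se n := gen (Gen.T k)

theorem rel (n : ℕ) :
    CliffordLaurent (fun k : Fin n => gen (Gen.C k)) (fun k => gen (Gen.X k))
      (fun k => gen (Gen.Xinv k)) where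
  c_sq k := by simpa [gen] using RingQuot.mkAlgHom_rel Cq (Rel.cliff_sq k)
  c_anti h := by simpa [gen] using RingQuot.mkAlgHom_rel Cq (Rel.cliff_anti _ _ h)
  xy k := by simpa [gen] using RingQuot.mkAlgHom_rel Cq (Rel.X_Xinv k)
  yx k := by simpa [gen] using RingQuot.mkAlgHom_rel Cq (Rel.Xinv_X k)
  xx k l := by simpa [gen] using RingQuot.mkAlgHom_rel Cq (Rel.X_comm k l)
  cx_same k := by simpa [gen] using RingQuot.mkAlgHom_rel Cq (Rel.CX_same k)
  cx_far h := by simpa [gen] using RingQuot.mkAlgHom_rel Cq (Rel.CX_far _ _ h)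

theorem cross (k : Fin (n - 1)) :
    CrossRel ε (fun k : Fin n => gen (Gen.C k)) (fun k => gen (Gen.X k)) (t k) (lo k) (hi k) where
  tc_lo := by simpa [gen] using RingQuot.mkAlgHom_rel Cq (Rel.TC_lo k)
  tc_hi := by simpa [gen, Algebra.smul_def] using RingQuot.mkAlgHom_rel Cq (Rel.TC_hi k)
  tc_far h₁ h₂ := by simpa [gen] using RingQuot.mkAlgHom_rel Cq (Rel.TC_far k _ h₁ h₂)
  tx_lo := by simpa [gen, Algebra.smul_def] using RingQuot.mkAlgHom_rel Cq (Rel.TX_lo k)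
  tx_hi := by
    simpa [gen, Algebra.smul_def, mul_assoc] using RingQuot.mkAlgHom_rel Cq (Rel.TX_hi k)
  tx_far h₁ h₂ := by simpa [gen] using RingQuot.mkAlgHom_rel Cq (Rel.TX_far k _ h₁ h₂)

theorem q_mul_inv : q * q⁻¹ = 1 := mul_inv_cancel₀ RatFunc.X_ne_zero

theorem hecke_iff {R : Type*} [Ring R] [Algebra Cq R] (t : R) :
    (t - algebraMap Cq R q) * (t + algebraMap Cq R q⁻¹) = 0 ↔ t * t = ε • t + 1 := by
  have e : (t - algebraMap Cq R q) * (t + algebraMap Cq R q⁻¹) = t * t - (ε • t + 1) := by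
    simp only [sub_mul, mul_add, ← map_mul, q_mul_inv, map_one, ε, sub_smul,
      ← Algebra.commutes q⁻¹ t, ← Algebra.smul_def]
    abel
  rw [e, sub_eq_zero]

theorem t_sq (k : Fin (n - 1)) : t k * t k = ε • t k + 1 := by
  rw [← hecke_iff]
  simpa [gen] using RingQuot.mkAlgHom_rel Cq (Rel.hecke_quad k)

theorem t_braid (k l : Fin (n - 1)) (h : (l : ℕ) = k + 1) : t k * t l * t k = t l * t k * t l := by
  simpa [gen] using RingQuot.mkAlgHom_rel Cq (Rel.hecke_braid k l h)

theorem t_comm (k l : Fin (n - 1)) (h : (k : ℕ) + 1 < l) : t k * t l = t l * t k := by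
  simpa [gen] using RingQuot.mkAlgHom_rel Cq (Rel.hecke_comm k l h)

theorem induction {P : Se n → Prop} (a : Se n) (hr : ∀ r : Cq, P (algebraMap Cq _ r))
    (hg : ∀ g, P (gen g)) (hadd : ∀ a b, P a → P b → P (a + b))
    (hmul : ∀ a b, P a → P b → P (a * b)) : P a := by
  obtain ⟨b, rfl⟩ := RingQuot.mkAlgHom_surjective Cq (Rel n) a
  induction b using FreeAlgebra.induction with
  | grade0 r => simpa using hr r
  | grade1 g => exact hg g
  | mul a b ha hb => rw [map_mul]; exact hmul _ _ ha hb
  | add a b ha hb => rw [map_add]; exact hadd _ _ ha hb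

/-- The values of the lifted homomorphism on the generators. -/
def liftGen {R : Type*} (t' : Fin (n - 1) → R) (c' x' y' : Fin n → R) : Gen n → R
  | .T k => t' k
  | .C k => c' k
  | .X k => x' k
  | .Xinv k => y' k

section Lift

variable {R : Type*} [Ring R] [Algebra Cq R] {c' x' y' : Fin n → R} {t' : Fin (n - 1) → R}

/-- The universal property of `Se_n(q)`. -/
def lift (h : CliffordLaurent c' x' y') (r : ∀ k, CrossRel ε c' x' (t' k) (lo k) (hi k))
    (hsq : ∀ k, t' k * t' k = ε • t' k + 1)
    (hbraid : ∀ k l : Fin (n - 1), (l : ℕ) = k + 1 → t' k * t' l * t' k = t' l * t' k * t' l)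
    (hcomm : ∀ k l : Fin (n - 1), (k : ℕ) + 1 < l → t' k * t' l = t' l * t' k) :
    Se n →ₐ[Cq] R :=
  RingQuot.liftAlgHom Cq ⟨FreeAlgebra.lift Cq (liftGen t' c' x' y'), by
    intro a b hab
    cases hab with
    | hecke_quad k => simpa [liftGen] using (hecke_iff _).2 (hsq k)
    | hecke_braid k l h => simpa [liftGen] using hbraid k l h
    | hecke_comm k l h => simpa [liftGen] using hcomm k l h
    | cliff_sq k => simpa [liftGen] using h.c_sq k
    | cliff_anti k l hkl => simpa [liftGen] using h.c_anti hkl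
    | TC_lo k => simpa [liftGen] using (r k).tc_lo
    | TC_hi k => simpa [liftGen, Algebra.smul_def] using (r k).tc_hi
    | TC_far k l h₁ h₂ => simpa [liftGen] using (r k).tc_far h₁ h₂
    | X_Xinv k => simpa [liftGen] using h.xy k
    | Xinv_X k => simpa [liftGen] using h.yx k
    | X_comm k l => simpa [liftGen] using h.xx k l
    | TX_lo k => simpa [liftGen, Algebra.smul_def] using (r k).tx_lo
    | TX_hi k => simpa [liftGen, Algebra.smul_def, mul_assoc] using (r k).tx_hi
    | TX_far k l h₁ h₂ => simpa [liftGen] using (r k).tx_far h₁ h₂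
    | CX_same k => simpa [liftGen] using h.cx_same k
    | CX_far k l hkl => simpa [liftGen] using h.cx_far hkl⟩

theorem lift_gen (h : CliffordLaurent c' x' y') (r : ∀ k, CrossRel ε c' x' (t' k) (lo k) (hi k))
    (hsq hbraid hcomm) (g : Gen n) :
    lift h r hsq hbraid hcomm (gen g) = liftGen t' c' x' y' g := by
  simp [lift, gen]

end Lift

/-- The homomorphism `CL n → Se_n(q)`. -/
def ofCL (n : ℕ) : CL n →ₐ[Cq] Se n := CL.lift (rel n)

@[simp] theorem ofCL_c (k : Fin n) : ofCL n (CL.c k) = gen (.C k) := CL.lift_c _ k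
@[simp] theorem ofCL_x (k : Fin n) : ofCL n (CL.x k) = gen (.X k) := CL.lift_x _ k
@[simp] theorem ofCL_y (k : Fin n) : ofCL n (CL.y k) = gen (.Xinv k) := CL.lift_y _ k

/-- In any algebra, the cross relations for a single `T_k` determine how it moves past all of
`CL n`. -/
theorem _root_.AffineSergeev.CL.t_mul {R : Type*} [Ring R] [Algebra Cq R] (f : CL n →ₐ[Cq] R)
    (k : Fin (n - 1)) (t : R)
    (r : CrossRel ε (fun l => f (CL.c l)) (fun l => f (CL.x l)) t (lo k) (hi k)) (a : CL n) :
    t * f a = f (CL.s k a) * t + f (CL.d k a) := by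
  have h := (CL.rel n).map f
  have hne := CL.lo_ne_hi k
  induction a using CL.induction with
  | hr a => simp [CL.s_algebraMap, CL.d_algebraMap, Algebra.commutes]
  | hc l =>
    rw [CL.s_c, CL.d_c]
    by_cases h₁ : l = lo k
    · simp [h₁, dC_of_ne, hne, r.tc_lo]
    by_cases h₂ : l = hi k
    · simp [h₂, dC_hi, r.tc_hi, sub_eq_add_neg]
    · simp [dC_of_ne, h₂, Equiv.swap_apply_of_ne_of_ne h₁ h₂, r.tc_far h₁ h₂]
  | hx l =>
    rw [CL.s_x, CL.d_x]
    by_cases h₁ : l = lo k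
    · simp [h₁, dX_lo, r.tx_lo, sub_eq_add_neg]
    by_cases h₂ : l = hi k
    · simp [h₂, dX_hi _ hne, r.tx_hi]
    · simp [dX_of_ne, h₁, h₂, Equiv.swap_apply_of_ne_of_ne h₁ h₂, r.tx_far h₁ h₂]
  | hy l =>
    rw [CL.s_y, CL.d_y]
    by_cases h₁ : l = lo k
    · simp [h₁, dY_lo, r.ty_lo h]
    by_cases h₂ : l = hi k
    · simp [h₂, dY_hi _ hne, r.ty_hi h, sub_eq_add_neg]
    · simp [dY_of_ne, h₁, h₂, Equiv.swap_apply_of_ne_of_ne h₁ h₂, r.ty_far h h₁ h₂]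
  | hadd a b ha hb => simp only [map_add, mul_add, add_mul, ha, hb]; abel
  | hmul a b ha hb =>
    simp only [CL.s_mul, CL.d_mul, map_add, map_mul, mul_add, add_mul, mul_assoc, hb,
      mul_reassoc ha]
    abel

theorem t_mul_ofCL (k : Fin (n - 1)) (a : CL n) :
    t k * ofCL n a = ofCL n (CL.s k a) * t k + ofCL n (CL.d k a) :=
  CL.t_mul (ofCL n) k (t k) (by simpa using cross k) a

end Se

variable {n : ℕ}

/-! ### Adjacent transpositions and descents -/

/-- The transposition of the indices `k` and `k + 1`. -/
def adj (k : Fin (n - 1)) : Equiv.Perm (Fin n) := Equiv.swap (lo k) (hi k)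

/-- `k` is a left descent of `w`: the value `k + 1` occurs before the value `k` in `w`. -/
def Desc (k : Fin (n - 1)) (w : Equiv.Perm (Fin n)) : Prop := w⁻¹ (hi k) < w⁻¹ (lo k)

theorem adj_mul_adj (k : Fin (n - 1)) : adj k * adj k = 1 := Equiv.swap_mul_self _ _

@[simp] theorem adj_mul_adj_mul (k : Fin (n - 1)) (w : Equiv.Perm (Fin n)) :
    adj k * (adj k * w) = w := by rw [← mul_assoc, adj_mul_adj, one_mul]

theorem adj_mul_inv_apply (k : Fin (n - 1)) (w : Equiv.Perm (Fin n)) (i : Fin n) :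
    (adj k * w)⁻¹ i = w⁻¹ (adj k i) := by
  simp [mul_inv_rev, adj, Equiv.swap_inv]

@[simp] theorem adj_lo (k : Fin (n - 1)) : adj k (lo k) = hi k := Equiv.swap_apply_left _ _
@[simp] theorem adj_hi (k : Fin (n - 1)) : adj k (hi k) = lo k := Equiv.swap_apply_right _ _

theorem adj_of_ne {k : Fin (n - 1)} {i : Fin n} (h₁ : i ≠ lo k) (h₂ : i ≠ hi k) : adj k i = i :=
  Equiv.swap_apply_of_ne_of_ne h₁ h₂

theorem desc_adj_mul (k : Fin (n - 1)) (w : Equiv.Perm (Fin n)) :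
    Desc k (adj k * w) ↔ ¬ Desc k w := by
  have : w⁻¹ (lo k) ≠ w⁻¹ (hi k) := (Equiv.injective _).ne (CL.lo_ne_hi k)
  simp only [Desc, adj_mul_inv_apply, adj_hi, adj_lo, not_lt]
  exact this.le_iff_lt.symm

theorem ne_of_far {k l : Fin (n - 1)} (h : (k : ℕ) + 1 < l) :
    lo k ≠ lo l ∧ lo k ≠ hi l ∧ hi k ≠ lo l ∧ hi k ≠ hi l := by
  simp only [ne_eq, lo, hi, Fin.mk.injEq]
  omega

theorem hi_eq_lo {k l : Fin (n - 1)} (h : (l : ℕ) = k + 1) : hi k = lo l := by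
  simp [lo, hi, h]

theorem lo_ne_hi_of_succ {k l : Fin (n - 1)} (h : (l : ℕ) = k + 1) : lo k ≠ hi l := by
  simp only [ne_eq, lo, hi, Fin.mk.injEq]
  omega

theorem adj_comm {k l : Fin (n - 1)} (h : (k : ℕ) + 1 < l) : adj k * adj l = adj l * adj k := by
  obtain ⟨h₁, h₂, h₃, h₄⟩ := ne_of_far h
  refine Equiv.Perm.Disjoint.commute fun i => ?_
  by_cases a : i = lo k
  · exact .inr (by rw [a, adj_of_ne h₁ h₂])
  by_cases b : i = hi k
  · exact .inr (by rw [b, adj_of_ne h₃ h₄])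
  · exact .inl (adj_of_ne a b)

theorem desc_adj_mul_of_far {k l : Fin (n - 1)} (h : (k : ℕ) + 1 < l) (w : Equiv.Perm (Fin n)) :
    (Desc k (adj l * w) ↔ Desc k w) ∧ (Desc l (adj k * w) ↔ Desc l w) := by
  obtain ⟨h₁, h₂, h₃, h₄⟩ := ne_of_far h
  simp only [Desc, adj_mul_inv_apply, adj_of_ne h₁ h₂, adj_of_ne h₃ h₄, adj_of_ne h₁.symm h₃.symm,
    adj_of_ne h₂.symm h₄.symm, and_self]

theorem adj_braid {k l : Fin (n - 1)} (h : (l : ℕ) = k + 1) :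
    adj k * (adj l * adj k) = adj l * (adj k * adj l) := by
  have e := hi_eq_lo h
  have h₁ := lo_ne_hi_of_succ h
  have h₂ := CL.lo_ne_hi k
  have h₃ := CL.lo_ne_hi l
  ext i : 1
  simp only [adj, Equiv.Perm.mul_apply, e] at *
  by_cases a : i = lo k
  · subst a; simp [Equiv.swap_apply_of_ne_of_ne, *, h₁.symm, h₃.symm]
  by_cases b : i = lo l
  · subst b; simp [Equiv.swap_apply_of_ne_of_ne, *, h₁.symm, h₃.symm]
  by_cases c : i = hi l
  · subst c; simp [Equiv.swap_apply_of_ne_of_ne, *, h₁.symm, h₃.symm]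
  · simp [Equiv.swap_apply_of_ne_of_ne, *]

/-- The descents of `w` and its translates at two neighbouring indices, in terms of the order of
the positions in `w` of the three values concerned. -/
theorem desc_braid {k l : Fin (n - 1)} (h : (l : ℕ) = k + 1) (w : Equiv.Perm (Fin n)) :
    (Desc k (adj l * w) ↔ w⁻¹ (hi l) < w⁻¹ (lo k)) ∧
    (Desc l (adj k * w) ↔ w⁻¹ (hi l) < w⁻¹ (lo k)) ∧
    (Desc k (adj l * (adj k * w)) ↔ Desc l w) ∧ (Desc l (adj k * (adj l * w)) ↔ Desc k w) := by
  have e := hi_eq_lo h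
  have h₁ := lo_ne_hi_of_succ h
  have h₂ := CL.lo_ne_hi k
  have h₃ := CL.lo_ne_hi l
  have a₁ : adj k (lo k) = lo l := by rw [adj_lo, e]
  have a₂ : adj k (lo l) = lo k := by rw [← e, adj_hi]
  have a₃ : adj k (hi l) = hi l := adj_of_ne h₁.symm (e ▸ h₃.symm)
  have a₄ : adj l (lo k) = lo k := adj_of_ne (e ▸ h₂) h₁
  simp only [Desc, adj_mul_inv_apply, e, a₁, a₂, a₃, a₄, adj_lo, adj_hi, and_self]

/-! ### The regular representation of the finite Hecke algebra -/

open scoped Classical in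
/-- The action of `T_k` on the coordinates with respect to the basis `T_w` of the Hecke algebra. -/
def heckeOp (k : Fin (n - 1)) (f : Equiv.Perm (Fin n) → Cq) : Equiv.Perm (Fin n) → Cq :=
  fun w => f (adj k * w) + if Desc k w then ε * f w else 0

theorem heckeOp_sq (k : Fin (n - 1)) (f : Equiv.Perm (Fin n) → Cq) (w : Equiv.Perm (Fin n)) :
    heckeOp k (heckeOp k f) w = ε * heckeOp k f w + f w := by
  by_cases h : Desc k w <;> simp [heckeOp, desc_adj_mul, h] <;> ring

theorem heckeOp_comm {k l : Fin (n - 1)} (h : (k : ℕ) + 1 < l) (f : Equiv.Perm (Fin n) → Cq) :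
    heckeOp k (heckeOp l f) = heckeOp l (heckeOp k f) := by
  funext w
  have e : adj l * (adj k * w) = adj k * (adj l * w) := by rw [← mul_assoc, ← adj_comm h, mul_assoc]
  by_cases h₁ : Desc k w <;> by_cases h₂ : Desc l w <;>
  · simp only [heckeOp, desc_adj_mul_of_far h, h₁, h₂, e, if_true, if_false]
    try ring

theorem heckeOp_braid {k l : Fin (n - 1)} (h : (l : ℕ) = k + 1) (f : Equiv.Perm (Fin n) → Cq) :
    heckeOp k (heckeOp l (heckeOp k f)) = heckeOp l (heckeOp k (heckeOp l f)) := by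
  funext w
  have e : adj l * (adj k * (adj l * w)) = adj k * (adj l * (adj k * w)) := by
    simpa [mul_assoc] using congrArg (· * w) (adj_braid h).symm
  obtain ⟨d₁, d₂, d₃, d₄⟩ := desc_braid h w
  have D₁ : Desc k w ↔ w⁻¹ (lo l) < w⁻¹ (lo k) := by rw [Desc, hi_eq_lo h]
  have D₂ : Desc l w ↔ w⁻¹ (hi l) < w⁻¹ (lo l) := Iff.rfl
  by_cases h₁ : Desc k w <;> by_cases h₂ : Desc l w
  · have h₃ : w⁻¹ (hi l) < w⁻¹ (lo k) := (D₂.1 h₂).trans (D₁.1 h₁)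
    simp only [heckeOp, desc_adj_mul, d₁, d₂, d₃, d₄, h₁, h₂, h₃, e, adj_mul_adj_mul, if_true,
      if_false, not_true_eq_false]
    ring
  · by_cases h₃ : w⁻¹ (hi l) < w⁻¹ (lo k) <;>
    simp only [heckeOp, desc_adj_mul, d₁, d₂, d₃, d₄, h₁, h₂, h₃, e, adj_mul_adj_mul, if_true,
      if_false, not_true_eq_false, not_false_eq_true] <;> ring
  · by_cases h₃ : w⁻¹ (hi l) < w⁻¹ (lo k) <;>
    simp only [heckeOp, desc_adj_mul, d₁, d₂, d₃, d₄, h₁, h₂, h₃, e, adj_mul_adj_mul, if_true,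
      if_false, not_true_eq_false, not_false_eq_true] <;> ring
  · have h₃ : ¬ w⁻¹ (hi l) < w⁻¹ (lo k) := by
      rw [D₁, not_lt] at h₁
      rw [D₂, not_lt] at h₂
      exact not_lt.2 (h₁.trans h₂)
    simp only [heckeOp, desc_adj_mul, d₁, d₂, d₃, d₄, h₁, h₂, h₃, e, adj_mul_adj_mul, if_true,
      if_false, not_false_eq_true]

/-! ### Products along reduced words -/

/-- A statistic on permutations that decreases along descents. -/
def potential (w : Equiv.Perm (Fin n)) : ℕ := ∑ i : Fin n, (i : ℕ) * (Fin.rev (w⁻¹ i) : ℕ)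

theorem potential_lt {k : Fin (n - 1)} {w : Equiv.Perm (Fin n)} (h : Desc k w) :
    potential (adj k * w) < potential w := by
  have e : potential (adj k * w) = ∑ i : Fin n, (adj k i : ℕ) * (Fin.rev (w⁻¹ i) : ℕ) := by
    rw [potential, ← Equiv.sum_comp (adj k)]
    refine Finset.sum_congr rfl fun i _ => ?_
    have : adj k (adj k i) = i := by rw [← Equiv.Perm.mul_apply, adj_mul_adj, Equiv.Perm.one_apply]
    rw [adj_mul_inv_apply, this]
  rw [e, potential, ← Nat.cast_lt (α := ℤ), ← sub_pos, Nat.cast_sum, Nat.cast_sum,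
    ← Finset.sum_sub_distrib, Fintype.sum_eq_add (lo k) (hi k) (CL.lo_ne_hi k)]
  · have h' : (Fin.rev (w⁻¹ (lo k)) : ℕ) < Fin.rev (w⁻¹ (hi k)) := Fin.rev_lt_rev.2 h
    have a : ((lo k : Fin n) : ℕ) = k := rfl
    have b : ((hi k : Fin n) : ℕ) = k + 1 := rfl
    zify at h'
    rw [adj_lo, adj_hi, a, b]
    push_cast
    linarith
  · rintro i ⟨h₁, h₂⟩
    rw [adj_of_ne h₁ h₂, sub_self]

theorem exists_desc {w : Equiv.Perm (Fin n)} (hw : w ≠ 1) : ∃ k, Desc k w := by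
  by_contra! h
  refine hw (inv_eq_one.1 ?_)
  rcases n with _ | m
  · exact Subsingleton.elim _ _
  have mono : StrictMono (w⁻¹ : Equiv.Perm (Fin (m + 1))) := by
    rw [Fin.strictMono_iff_lt_succ]
    intro i
    exact lt_of_le_of_ne (not_lt.1 (h i)) ((Equiv.injective _).ne (CL.lo_ne_hi (n := m + 1) i))
  ext i : 1
  refine congrFun ((mono.range_inj strictMono_id).1 ?_) i
  rw [(Equiv.surjective _).range_eq, Set.range_id]

theorem perm_induction {P : Equiv.Perm (Fin n) → Prop} (h₁ : P 1)
    (h : ∀ k w, Desc k w → P (adj k * w) → P w) (w : Equiv.Perm (Fin n)) : P w := by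
  induction hm : potential w using Nat.strong_induction_on generalizing w with
  | _ m ih =>
    by_cases hw : w = 1
    · exact hw ▸ h₁
    · obtain ⟨k, hk⟩ := exists_desc hw
      exact h k w hk (ih _ (hm ▸ potential_lt hk) _ rfl)

section ReducedProd

variable {G : Type*} [Monoid G]

open scoped Classical in
/-- The product of the `t_k` along a reduced word for `w`, obtained by repeatedly splitting off some
descent. -/
def reducedProd (t : Fin (n - 1) → G) (w : Equiv.Perm (Fin n)) : G :=
  if h : ∃ k, Desc k w then t h.choose * reducedProd t (adj h.choose * w) else 1
termination_by potential w
decreasing_by exact potential_lt h.choose_spec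

theorem not_desc_one (k : Fin (n - 1)) : ¬ Desc k 1 := by
  simp [Desc, lo, hi]

@[simp] theorem reducedProd_one (t : Fin (n - 1) → G) : reducedProd t 1 = 1 := by
  rw [reducedProd, dif_neg]
  rintro ⟨k, hk⟩
  exact not_desc_one k hk

/-- Matsumoto's theorem for the symmetric group: `reducedProd` does not depend on
which descents are split off. -/
theorem reducedProd_of_desc {t : Fin (n - 1) → G}
    (hbraid : ∀ k l : Fin (n - 1), (l : ℕ) = k + 1 → t k * t l * t k = t l * t k * t l)
    (hcomm : ∀ k l : Fin (n - 1), (k : ℕ) + 1 < l → t k * t l = t l * t k)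
    (w : Equiv.Perm (Fin n)) {k : Fin (n - 1)} (hk : Desc k w) :
    reducedProd t w = t k * reducedProd t (adj k * w) := by
  induction hm : potential w using Nat.strong_induction_on generalizing w k with
  | _ m ih =>
  subst hm
  have far : ∀ {k l}, Desc k w → Desc l w → (k : ℕ) + 1 < l →
      t k * reducedProd t (adj k * w) = t l * reducedProd t (adj l * w) := by
    intro k l hk hl hkl
    rw [ih _ (potential_lt hk) _ ((desc_adj_mul_of_far hkl w).2.2 hl) rfl,
      ih _ (potential_lt hl) _ ((desc_adj_mul_of_far hkl w).1.2 hk) rfl,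
      ← mul_assoc, ← mul_assoc, ← mul_assoc, ← mul_assoc, hcomm k l hkl, adj_comm hkl]
  have near : ∀ {k l}, Desc k w → Desc l w → (l : ℕ) = k + 1 →
      t k * reducedProd t (adj k * w) = t l * reducedProd t (adj l * w) := by
    intro k l hk hl hkl
    obtain ⟨d₁, d₂, d₃, d₄⟩ := desc_braid hkl w
    have hR : w⁻¹ (hi l) < w⁻¹ (lo k) := by
      have h₁ : w⁻¹ (hi l) < w⁻¹ (lo l) := hl
      have h₂ : w⁻¹ (hi k) < w⁻¹ (lo k) := hk
      exact h₁.trans (hi_eq_lo hkl ▸ h₂)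
    have hk' := potential_lt hk
    have hl' := potential_lt hl
    rw [ih _ hk' _ (d₂.2 hR) rfl, ih _ ((potential_lt (d₂.2 hR)).trans hk') _ (d₃.2 hl) rfl,
      ih _ hl' _ (d₁.2 hR) rfl, ih _ ((potential_lt (d₁.2 hR)).trans hl') _ (d₄.2 hk) rfl]
    have e : adj l * (adj k * (adj l * w)) = adj k * (adj l * (adj k * w)) := by
      simpa [mul_assoc] using congrArg (· * w) (adj_braid hkl).symm
    rw [e, ← mul_assoc, ← mul_assoc, hbraid k l hkl]
    simp only [mul_assoc]
  have hex : ∃ k, Desc k w := ⟨k, hk⟩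
  rw [reducedProd, dif_pos hex]
  have hj := hex.choose_spec
  generalize hex.choose = j at hj
  rcases lt_trichotomy (j : ℕ) k with h | h | h
  · rcases (Nat.succ_le_of_lt h).eq_or_lt with h | h
    · exact near hj hk h.symm
    · exact far hj hk h
  · rw [Fin.ext h]
  · rcases (Nat.succ_le_of_lt h).eq_or_lt with h | h
    · exact (near hk hj h.symm).symm
    · exact (far hk hj h).symm

end ReducedProd

/-- The length of a permutation, that is, the number of factors in a reduced word. -/
def len (w : Equiv.Perm (Fin n)) : ℕ :=
  Multiplicative.toAdd (reducedProd (fun _ => Multiplicative.ofAdd (1 : ℕ)) w)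

@[simp] theorem len_one : len (1 : Equiv.Perm (Fin n)) = 0 := by simp [len]

theorem len_of_desc {k : Fin (n - 1)} {w : Equiv.Perm (Fin n)} (h : Desc k w) :
    len w = len (adj k * w) + 1 := by
  rw [len, reducedProd_of_desc (fun _ _ _ => rfl) (fun _ _ _ => rfl) w h, toAdd_mul, add_comm]
  rfl

theorem len_adj_mul_le (k : Fin (n - 1)) (w : Equiv.Perm (Fin n)) :
    len (adj k * w) ≤ len w + 1 := by
  by_cases h : Desc k w
  · rw [len_of_desc h]; omega
  · have := len_of_desc ((desc_adj_mul k w).2 h)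
    rw [adj_mul_adj_mul] at this
    omega

/-! ### The regular representation of the affine Sergeev algebra -/

/-- The module on which `Se_n(q)` acts: a function `m` stands for the sum of the `m w • T_w`. -/
abbrev Reg (n : ℕ) : Type := Equiv.Perm (Fin n) → CL n

namespace Reg

/-- The action of `CL n` on the module `Reg n`. -/
def ofCL (n : ℕ) : CL n →ₐ[Cq] Module.End Cq (Reg n) := Algebra.lsmul Cq Cq (Reg n)

theorem ofCL_apply (a : CL n) (m : Reg n) (w : Equiv.Perm (Fin n)) :
    ofCL n a m w = a * m w := rfl

open scoped Classical in
/-- The action of `T_k` on the module `Reg n`. -/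
def t (k : Fin (n - 1)) : Module.End Cq (Reg n) where
  toFun m w := CL.s k (m (adj k * w)) + (if Desc k w then ε • CL.s k (m w) else 0) + CL.d k (m w)
  map_add' m m' := by
    funext w
    by_cases h : Desc k w <;> simp [h] <;> abel
  map_smul' r m := by
    funext w
    by_cases h : Desc k w <;> simp [h, smul_comm ε r]

open scoped Classical in
theorem t_apply (k : Fin (n - 1)) (m : Reg n) (w : Equiv.Perm (Fin n)) :
    t k m w =
      CL.s k (m (adj k * w)) + (if Desc k w then ε • CL.s k (m w) else 0) + CL.d k (m w) := rfl

theorem t_mul_ofCL (k : Fin (n - 1)) (a : CL n) :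
    t k * ofCL n a = ofCL n (CL.s k a) * t k + ofCL n (CL.d k a) := by
  refine LinearMap.ext fun m => funext fun w => ?_
  by_cases h : Desc k w <;>
  · simp only [Module.End.mul_apply, LinearMap.add_apply, Pi.add_apply, t_apply, ofCL_apply, h,
      CL.s_mul, CL.d_mul, if_true, if_false, mul_add, mul_smul_comm, mul_zero]
    abel

theorem rel (n : ℕ) :
    CliffordLaurent (fun k => ofCL n (CL.c k)) (fun k => ofCL n (CL.x k))
      (fun k => ofCL n (CL.y k)) := (CL.rel n).map (ofCL n)

theorem cross (k : Fin (n - 1)) :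
    CrossRel ε (fun k => ofCL n (CL.c k)) (fun k => ofCL n (CL.x k)) (t k) (lo k) (hi k) := by
  have hne := CL.lo_ne_hi k
  constructor
  · simp [t_mul_ofCL, CL.s_c, CL.d_c, dC_of_ne, hne]
  · simp only [t_mul_ofCL, CL.s_c, CL.d_c, dC_hi, Equiv.swap_apply_right, map_neg, map_smul, map_sub,
      ← sub_eq_add_neg]
  · intro l h₁ h₂
    simp [t_mul_ofCL, CL.s_c, CL.d_c, dC_of_ne, h₂, Equiv.swap_apply_of_ne_of_ne h₁ h₂]
  · simp only [t_mul_ofCL, CL.s_x, CL.d_x, dX_lo, Equiv.swap_apply_left, map_neg, map_smul, map_sub,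
      map_mul, ← sub_eq_add_neg]
  · simp [t_mul_ofCL, CL.s_x, CL.d_x, dX_hi _ hne]
  · intro l h₁ h₂
    simp [t_mul_ofCL, CL.s_x, CL.d_x, dX_of_ne, h₁, h₂, Equiv.swap_apply_of_ne_of_ne h₁ h₂]

/-- Functions with values in scalars, as elements of `Reg n`. -/
def scalar (f : Equiv.Perm (Fin n) → Cq) : Reg n := fun w => algebraMap Cq (CL n) (f w)

theorem t_scalar (k : Fin (n - 1)) (f : Equiv.Perm (Fin n) → Cq) :
    t k (scalar f) = scalar (heckeOp k f) := by
  funext w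
  by_cases h : Desc k w <;>
    simp [t_apply, scalar, heckeOp, h, CL.s_algebraMap, CL.d_algebraMap, Algebra.smul_def]

/-- An operator on `Reg n` that commutes with the generators of `CL n` up to a
permutation of the indices vanishes if it kills the scalar functions. -/
theorem eq_zero_of_scalar {E : Module.End Cq (Reg n)}
    (hc : ∀ k, ∃ l, E * ofCL n (CL.c k) = ofCL n (CL.c l) * E)
    (hx : ∀ k, ∃ l, E * ofCL n (CL.x k) = ofCL n (CL.x l) * E)
    (h0 : ∀ f, E (scalar f) = 0) : E = 0 := by
  have h := rel n
  have key : ∀ (a : CL n) (m : Reg n), E m = 0 → E (ofCL n a m) = 0 := by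
    intro a
    induction a using CL.induction with
    | hr r => intro m hm; simp [Algebra.algebraMap_eq_smul_one, hm]
    | hc k =>
      intro m hm
      obtain ⟨l, hl⟩ := hc k
      rw [← Module.End.mul_apply, hl, Module.End.mul_apply, hm, map_zero]
    | hx k =>
      intro m hm
      obtain ⟨l, hl⟩ := hx k
      rw [← Module.End.mul_apply, hl, Module.End.mul_apply, hm, map_zero]
    | hy k =>
      intro m hm
      obtain ⟨l, hl⟩ := hx k
      have e : E * ofCL n (CL.y k) = ofCL n (CL.y l) * E := by
        have := congrArg (fun z => ofCL n (CL.y l) * z * ofCL n (CL.y k)) hl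
        simp only [mul_assoc, h.xy, mul_one, mul_reassoc (h.yx l), one_mul] at this
        exact this.symm
      rw [← Module.End.mul_apply, e, Module.End.mul_apply, hm, map_zero]
    | hadd a b ha hb => intro m hm; simp [ha m hm, hb m hm]
    | hmul a b ha hb => intro m hm; rw [map_mul]; exact ha _ (hb _ hm)
  refine LinearMap.ext fun m => ?_
  have e : m = ∑ w, ofCL n (m w) (scalar (Pi.single w 1)) := by
    funext v
    rw [Finset.sum_apply, Finset.sum_eq_single v]
    · simp [ofCL_apply, scalar]
    · intro w _ hw
      simp [ofCL_apply, scalar, Pi.single_eq_of_ne hw.symm]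
    · simp
  rw [e, map_sum]
  exact Finset.sum_eq_zero fun w _ => key _ _ (h0 _)

theorem t_sq (k : Fin (n - 1)) : t k * t k = ε • t k + (1 : Module.End Cq (Reg n)) := by
  rw [← sub_eq_zero, ← sub_sub (t k * t k) (ε • t k) 1]
  refine eq_zero_of_scalar (fun l => ⟨l, (cross k).quad_mul_c l⟩)
    (fun l => ⟨l, (cross k).quad_mul_x (rel n) (CL.lo_ne_hi k) l⟩) fun f => ?_
  funext w
  simp [t_scalar, scalar, heckeOp_sq, Algebra.smul_def]

theorem t_comm (k l : Fin (n - 1)) (h : (k : ℕ) + 1 < l) : t k * t l = t l * t k := by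
  obtain ⟨h₁, h₂, h₃, h₄⟩ := ne_of_far h
  have key := (cross k).comm_mul (cross l) h₁ h₂ h₃ h₄
  rw [← sub_eq_zero]
  refine eq_zero_of_scalar (fun l => (key l).1) (fun l => (key l).2) fun f => ?_
  simp [t_scalar, heckeOp_comm h]

theorem t_braid (k l : Fin (n - 1)) (h : (l : ℕ) = k + 1) :
    t k * t l * t k = t l * t k * t l := by
  have e := hi_eq_lo h
  have key := (cross k).braid_mul (rel n) (e ▸ cross l) (CL.lo_ne_hi k)
    (lo_ne_hi_of_succ h) (e ▸ CL.lo_ne_hi l) (t_sq k) (t_sq l)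
  rw [← sub_eq_zero]
  refine eq_zero_of_scalar (fun l => (key l).1) (fun l => (key l).2) fun f => ?_
  simp [t_scalar, heckeOp_braid h]

/-- The regular representation of `Se_n(q)`. -/
def ρ (n : ℕ) : Se n →ₐ[Cq] Module.End Cq (Reg n) :=
  Se.lift (rel n) cross t_sq t_braid t_comm

theorem ρ_t (k : Fin (n - 1)) : ρ n (Se.t k) = t k := Se.lift_gen ..

theorem ρ_ofCL (a : CL n) : ρ n (Se.ofCL n a) = ofCL n a := by
  suffices h : (ρ n).comp (Se.ofCL n) = ofCL n from DFunLike.congr_fun h a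
  refine CL.algHom_ext (fun k => ?_) (fun k => ?_) (fun k => ?_) <;>
  · simp only [AlgHom.comp_apply, Se.ofCL_c, Se.ofCL_x, Se.ofCL_y]
    exact Se.lift_gen ..

/-- The cyclic vector of the regular representation. -/
def e (n : ℕ) : Reg n := Pi.single 1 1

/-- The element `T_w` of `Se_n(q)`. -/
def T (w : Equiv.Perm (Fin n)) : Se n := reducedProd Se.t w

theorem T_of_desc {k : Fin (n - 1)} {w : Equiv.Perm (Fin n)} (h : Desc k w) :
    T w = Se.t k * T (adj k * w) := reducedProd_of_desc Se.t_braid Se.t_comm w h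

open scoped Classical in
theorem t_mul_T (k : Fin (n - 1)) (w : Equiv.Perm (Fin n)) :
    Se.t k * T w = T (adj k * w) + if Desc k w then ε • T w else 0 := by
  by_cases h : Desc k w
  · rw [if_pos h, T_of_desc h, ← mul_assoc, Se.t_sq, add_mul, one_mul, smul_mul_assoc, add_comm]
  · rw [if_neg h, add_zero, T_of_desc ((desc_adj_mul k w).2 h), adj_mul_adj_mul]

theorem t_single (k : Fin (n - 1)) {w : Equiv.Perm (Fin n)} (h : Desc k w) (a : CL n) :
    t k (Pi.single (adj k * w) a) =
      Pi.single w (CL.s k a) + Pi.single (adj k * w) (CL.d k a) := by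
  have h' : adj k * w ≠ w := fun e => by
    have := desc_adj_mul k w
    rw [e] at this
    tauto
  funext v
  rw [t_apply, Pi.add_apply]
  by_cases h₁ : v = w
  · subst h₁; simp [h'.symm]
  by_cases h₂ : v = adj k * w
  · subst h₂; simp [desc_adj_mul, h, h']
  · have : adj k * v ≠ adj k * w := fun e => h₁ (mul_left_cancel e)
    simp [h₁, h₂, this]

/-- The inverse of the map `z ↦ z e` from `Se_n(q)` to `Reg n`. -/
def toSe (m : Reg n) : Se n := ∑ w, Se.ofCL n (m w) * T w

theorem toSe_ρ (z : Se n) (m : Reg n) : toSe (ρ n z m) = z * toSe m := by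
  have hCL : ∀ (a : CL n) (m : Reg n), toSe (ρ n (Se.ofCL n a) m) = Se.ofCL n a * toSe m := by
    intro a m
    simp [toSe, ρ_ofCL, ofCL_apply, Finset.mul_sum, mul_assoc]
  induction z using Se.induction generalizing m with
  | hr r => simp [toSe, Algebra.algebraMap_eq_smul_one, Finset.smul_sum]
  | hg g =>
    rcases g with k | k | k | k
    · rw [ρ_t]
      have e₁ : ∑ w, Se.ofCL n (CL.s k (m (adj k * w))) * T w =
          ∑ w, Se.ofCL n (CL.s k (m w)) * T (adj k * w) := by
        rw [← Equiv.sum_comp (Equiv.mulLeft (adj k))]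
        simp
      simp only [toSe, t_apply, map_add, add_mul, Finset.sum_add_distrib, e₁, Finset.mul_sum,
        ← mul_assoc, Se.t_mul_ofCL]
      congr 1
      rw [← Finset.sum_add_distrib]
      refine Finset.sum_congr rfl fun w _ => ?_
      rw [mul_assoc, t_mul_T, mul_add]
      by_cases h : Desc k w <;> simp [h]
    · simpa using hCL (CL.c k) m
    · simpa using hCL (CL.x k) m
    · simpa using hCL (CL.y k) m
  | hadd a b ha hb =>
    rw [map_add, add_mul, ← ha, ← hb]
    simp [toSe, add_mul, Finset.sum_add_distrib]
  | hmul a b ha hb => rw [map_mul, Module.End.mul_apply, ha, hb, mul_assoc]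

theorem toSe_e : toSe (e n) = 1 := by
  rw [toSe, Finset.sum_eq_single 1]
  · simp [e, T]
  · intro w _ hw
    simp [e, Pi.single_eq_of_ne hw]
  · simp

/-- Every element of `Se_n(q)` is the combination of the `T_w` whose coefficients are the
coordinates of its value on the cyclic vector. -/
theorem toSe_ρ_e (z : Se n) : toSe (ρ n z (e n)) = z := by rw [toSe_ρ, toSe_e, mul_one]

theorem ofCL_e (a : CL n) : ρ n (Se.ofCL n a) (e n) = Pi.single 1 a := by
  rw [ρ_ofCL]
  funext w
  rw [ofCL_apply, e]
  by_cases h : w = 1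
  · subst h; simp
  · simp [Pi.single_eq_of_ne h]

/-- The algebra `CL n` is a subalgebra of `Se_n(q)`, as it acts freely on the cyclic vector. -/
theorem _root_.AffineSergeev.Se.ofCL_injective : Function.Injective (Se.ofCL n) := by
  intro a b h
  have := ofCL_e a
  rw [h, ofCL_e] at this
  exact (Pi.single_injective _ this).symm

end Reg

/-! ### Laurent polynomials -/

/-- Laurent polynomials in `n` variables, as the group algebra of the group of exponents. -/
abbrev Lau (n : ℕ) : Type := AddMonoidAlgebra Cq (Fin n → ℤ)

namespace Lau

/-- The Laurent monomial with given exponents. -/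
def mon (a : Fin n → ℤ) : Lau n := AddMonoidAlgebra.single a 1

theorem mon_mul (a b : Fin n → ℤ) : mon a * mon b = mon (a + b) := by
  simp [mon, AddMonoidAlgebra.single_mul_single]

theorem mon_zero : mon (0 : Fin n → ℤ) = 1 := rfl

theorem mon_injective : Function.Injective (mon (n := n)) := by
  intro a b h
  by_contra hab
  have := congrArg (fun z => z.coeff a) h
  simp [mon, Finsupp.single_eq_of_ne hab] at this

theorem mon_nsmul (a : Fin n → ℤ) (m : ℕ) : mon (m • a) = mon a ^ m := by
  induction m with
  | zero => simp [mon_zero]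
  | succ m ih => rw [succ_nsmul, ← mon_mul, ih, pow_succ]

theorem mon_sum {ι : Type*} (s : Finset ι) (f : ι → Fin n → ℤ) :
    mon (∑ i ∈ s, f i) = ∏ i ∈ s, mon (f i) := by
  classical
  induction s using Finset.induction_on with
  | empty => simp [mon_zero]
  | insert i s hi ih => rw [Finset.sum_insert hi, Finset.prod_insert hi, ← mon_mul, ih]

/-- The variable `X_i`. -/
def x (i : Fin n) : Lau n := mon (Pi.single i 1)

/-- The inverse of the variable `X_i`. -/
def y (i : Fin n) : Lau n := mon (-Pi.single i 1)

theorem x_mul_y (i : Fin n) : x i * y i = 1 := by simp [x, y, mon_mul, mon_zero]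

theorem mon_mem (S : Subalgebra Cq (Lau n)) (hx : ∀ i, x i ∈ S) (hy : ∀ i, y i ∈ S)
    (a : Fin n → ℤ) : mon a ∈ S := by
  have e : a = ∑ i, (Pi.single i (a i) : Fin n → ℤ) := (Finset.univ_sum_single a).symm
  rw [e, mon_sum]
  refine prod_mem fun i _ => ?_
  obtain ⟨m, h | h⟩ := Int.eq_nat_or_neg (a i)
  · have : (Pi.single i (a i) : Fin n → ℤ) = m • Pi.single i 1 := by
      rw [h, ← Pi.single_smul]; simp
    rw [this, mon_nsmul]
    exact pow_mem (hx i) m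
  · have : (Pi.single i (a i) : Fin n → ℤ) = m • -Pi.single i 1 := by
      rw [h, smul_neg, ← Pi.single_smul, ← Pi.single_neg]; simp
    rw [this, mon_nsmul]
    exact pow_mem (hy i) m

@[elab_as_elim]
theorem induction_mon {P : Lau n → Prop} (f : Lau n) (hm : ∀ a, P (mon a))
    (hadd : ∀ a b, P a → P b → P (a + b)) (hsmul : ∀ (r : Cq) a, P a → P (r • a)) : P f := by
  induction f using AddMonoidAlgebra.induction_on with
  | of a => exact hm a
  | add f g hf hg => exact hadd _ _ hf hg
  | smul r f hf => exact hsmul _ _ hf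

@[elab_as_elim]
theorem induction {P : Lau n → Prop} (f : Lau n) (hr : ∀ r : Cq, P (algebraMap Cq _ r))
    (hx : ∀ i, P (x i)) (hy : ∀ i, P (y i)) (hadd : ∀ a b, P a → P b → P (a + b))
    (hmul : ∀ a b, P a → P b → P (a * b)) : P f := by
  induction f using induction_mon with
  | hm a =>
    exact mon_mem
      { carrier := {f | P f}, mul_mem' := fun ha hb => hmul _ _ ha hb,
        add_mem' := fun ha hb => hadd _ _ ha hb, algebraMap_mem' := hr } hx hy a
  | hadd f g hf hg => exact hadd _ _ hf hg
  | hsmul r f hf => rw [Algebra.smul_def]; exact hmul _ _ (hr r) hf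

/-- Evaluation of Laurent polynomials at commuting units. -/
def eval {R : Type*} [Ring R] [Algebra Cq R] (u : Fin n → Rˣ)
    (hu : ∀ i j, Commute (u i : R) (u j)) : Lau n →ₐ[Cq] R :=
  AddMonoidAlgebra.lift Cq R (Fin n → ℤ) <|
    (Units.coeHom R).comp <|
      (MonoidHom.noncommPiCoprod (fun i => zpowersHom Rˣ (u i)) (by
        intro i j _ a b
        exact (Commute.zpow_zpow (Units.ext (hu i j)) _ _))).comp
      { toFun := fun a i => Multiplicative.ofAdd (a.toAdd i), map_one' := rfl,
        map_mul' := fun _ _ => rfl }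

section Eval

variable {R : Type*} [Ring R] [Algebra Cq R] (u : Fin n → Rˣ) (hu : ∀ i j, Commute (u i : R) (u j))

theorem eval_mon_single (i : Fin n) (m : ℤ) :
    eval u hu (mon (Pi.single i m)) = ((u i ^ m : Rˣ) : R) := by
  have e : (fun j => Multiplicative.ofAdd ((Pi.single i m : Fin n → ℤ) j)) =
      Pi.mulSingle (M := fun _ => Multiplicative ℤ) i (Multiplicative.ofAdd m) := by
    funext j
    by_cases h : j = i
    · subst h; simp
    · simp [h]
  simp only [eval, mon, AddMonoidAlgebra.lift_single, one_smul, MonoidHom.comp_apply,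
    MonoidHom.coe_mk, OneHom.coe_mk, toAdd_ofAdd, e, Units.coeHom_apply]
  exact congrArg Units.val
    (MonoidHom.noncommPiCoprod_mulSingle (ϕ := fun i => zpowersHom Rˣ (u i)) i _)

theorem eval_x (i : Fin n) : eval u hu (x i) = u i := by simp [x, eval_mon_single]

theorem eval_y (i : Fin n) : eval u hu (y i) = ((u i)⁻¹ : Rˣ) := by
  rw [y, ← Pi.single_neg, eval_mon_single, zpow_neg_one]

end Eval

/-- The action on exponents of the change of variables `X_k ↦ X_k⁻¹`. -/
def flipExp (k : Fin n) : (Fin n → ℤ) ≃+ (Fin n → ℤ) where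
  toFun a i := if i = k then -a i else a i
  invFun a i := if i = k then -a i else a i
  left_inv a := by funext i; by_cases h : i = k <;> simp [h]
  right_inv a := by funext i; by_cases h : i = k <;> simp [h]
  map_add' a b := by funext i; by_cases h : i = k <;> simp [h, add_comm]

/-- The automorphism `X_k ↦ X_k⁻¹` of the algebra of Laurent polynomials. -/
def flip (k : Fin n) : Lau n ≃ₐ[Cq] Lau n := AddMonoidAlgebra.domCongr Cq Cq (flipExp k)

/-- The action of permutations on exponents. -/
def permExp (w : Equiv.Perm (Fin n)) : (Fin n → ℤ) ≃+ (Fin n → ℤ) where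
  toFun a i := a (w⁻¹ i)
  invFun a i := a (w i)
  left_inv a := by funext i; simp
  right_inv a := by funext i; simp
  map_add' _ _ := rfl

/-- The automorphism `X_i ↦ X_{w(i)}` of the algebra of Laurent polynomials. -/
def perm (w : Equiv.Perm (Fin n)) : Lau n ≃ₐ[Cq] Lau n := AddMonoidAlgebra.domCongr Cq Cq (permExp w)

theorem flip_mon (k : Fin n) (a : Fin n → ℤ) : flip k (mon a) = mon (flipExp k a) := by
  simp [flip, mon]

theorem perm_mon (w : Equiv.Perm (Fin n)) (a : Fin n → ℤ) : perm w (mon a) = mon (permExp w a) := by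
  simp [perm, mon]

theorem flipExp_single_self (k : Fin n) (m : ℤ) :
    flipExp k (Pi.single k m) = -Pi.single k m := by
  funext i
  by_cases h : i = k
  · subst h; simp [flipExp]
  · simp [flipExp, h]

theorem flipExp_single_of_ne {k i : Fin n} (h : i ≠ k) (m : ℤ) :
    flipExp k (Pi.single i m) = Pi.single i m := by
  funext j
  by_cases hj : j = k
  · subst hj; simp [flipExp, h.symm]
  · simp [flipExp, hj]

@[simp] theorem flip_x_self (k : Fin n) : flip k (x k) = y k := by
  rw [x, flip_mon, flipExp_single_self, y]

@[simp] theorem flip_y_self (k : Fin n) : flip k (y k) = x k := by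
  rw [y, flip_mon, map_neg, flipExp_single_self, neg_neg, x]

theorem flip_x_of_ne {k i : Fin n} (h : i ≠ k) : flip k (x i) = x i := by
  rw [x, flip_mon, flipExp_single_of_ne h]

theorem flip_y_of_ne {k i : Fin n} (h : i ≠ k) : flip k (y i) = y i := by
  rw [y, flip_mon, map_neg, flipExp_single_of_ne h]

theorem permExp_single (w : Equiv.Perm (Fin n)) (i : Fin n) (m : ℤ) :
    permExp w (Pi.single i m) = Pi.single (w i) m := by
  funext j
  by_cases h : j = w i
  · subst h; simp [permExp]
  · have : w⁻¹ j ≠ i := fun e => h (by rw [← e]; simp)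
    simp only [permExp, AddEquiv.coe_mk, Equiv.coe_fn_mk, Pi.single_eq_of_ne h,
      Pi.single_eq_of_ne this]

@[simp] theorem perm_x (w : Equiv.Perm (Fin n)) (i : Fin n) : perm w (x i) = x (w i) := by
  rw [x, perm_mon, permExp_single, x]

@[simp] theorem perm_y (w : Equiv.Perm (Fin n)) (i : Fin n) : perm w (y i) = y (w i) := by
  rw [y, perm_mon, map_neg, permExp_single, y]

theorem flip_flip (k : Fin n) (f : Lau n) : flip k (flip k f) = f := by
  induction f using induction_mon with
  | hm a =>
    rw [flip_mon, flip_mon]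
    exact congrArg mon ((flipExp k).left_inv a)
  | hadd f g hf hg => simp [hf, hg]
  | hsmul r f hf => simp [hf]

theorem flip_comm (k l : Fin n) (f : Lau n) : flip k (flip l f) = flip l (flip k f) := by
  induction f using induction_mon with
  | hm a =>
    simp only [flip_mon]
    congr 1
    funext i
    simp only [flipExp, AddEquiv.coe_mk, Equiv.coe_fn_mk]
    split_ifs <;> rfl
  | hadd f g hf hg => simp [hf, hg]
  | hsmul r f hf => simp [hf]

end Lau

/-! ### The normal form in the subalgebra without the `T_k` -/

namespace CL

/-- The nontrivial character of `ℤ/2`. -/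
def chi (z : ZMod 2) : ℤ := if z = 0 then 1 else -1

theorem chi_add : ∀ a b : ZMod 2, chi (a + b) = chi a * chi b := by decide

/-- The sign in moving `C_k`, with `k ≥ m`, past the first `m` factors of the Clifford monomial with
exponents `S`. -/
def sgn (m : ℕ) (S : Fin n → ZMod 2) : ℤ :=
  ∏ j ∈ Finset.range m, if h : j < n then chi (S ⟨j, h⟩) else 1

theorem sgn_succ (m : ℕ) (hm : m < n) (S : Fin n → ZMod 2) :
    sgn (m + 1) S = sgn m S * chi (S ⟨m, hm⟩) := by
  rw [sgn, Finset.prod_range_succ, dif_pos hm, sgn]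

theorem sgn_add (m : ℕ) (S S' : Fin n → ZMod 2) : sgn m (S + S') = sgn m S * sgn m S' := by
  rw [sgn, sgn, sgn, ← Finset.prod_mul_distrib]
  refine Finset.prod_congr rfl fun j _ => ?_
  by_cases h : j < n <;> simp [h, chi_add]

theorem sgn_single (m : ℕ) (l : Fin n) :
    sgn m (Pi.single l 1) = if (l : ℕ) < m then -1 else 1 := by
  have e : ∀ j, (if h : j < n then chi ((Pi.single l 1 : Fin n → ZMod 2) ⟨j, h⟩) else 1) =
      if (l : ℕ) = j then -1 else 1 := by
    intro j
    by_cases hj : j < n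
    · by_cases h : (l : ℕ) = j
      · subst h; simp [chi]
      · have : (⟨j, hj⟩ : Fin n) ≠ l := fun e => h (by rw [← e])
        simp [hj, h, this, chi]
    · have : (l : ℕ) ≠ j := fun e => hj (e ▸ l.2)
      simp [hj, this]
  simp_rw [sgn, e]
  simp

theorem exponent_add_self (S : Fin n → ZMod 2) : S + S = 0 :=
  funext fun _ => CharTwo.add_self_eq_zero _

theorem sgn_mul_self (m : ℕ) (S : Fin n → ZMod 2) : sgn m S * sgn m S = 1 := by
  rw [← sgn_add, exponent_add_self, sgn]
  exact Finset.prod_eq_one fun j _ => by by_cases h : j < n <;> simp [h, chi]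

theorem add_single_add_single (S : Fin n → ZMod 2) (k : Fin n) :
    S + Pi.single k 1 + Pi.single k 1 = S := by
  rw [add_assoc, exponent_add_self, add_zero]

/-- The module on which `CL n` acts: a function `g` stands for the sum of the `g S • C^S`, where
`C^S` is the Clifford monomial with exponents `S`. -/
abbrev Nor (n : ℕ) : Type := (Fin n → ZMod 2) → Lau n

/-- Multiplication by a Laurent polynomial on `Nor n`. -/
def opL : Lau n →ₐ[Cq] Module.End Cq (Nor n) := Algebra.lsmul Cq Cq (Nor n)

theorem opL_apply (f : Lau n) (g : Nor n) (S : Fin n → ZMod 2) : opL f g S = f * g S := rfl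

/-- The action of `C_k` on `Nor n`. -/
def opC (k : Fin n) : Module.End Cq (Nor n) where
  toFun g S := sgn (k + 1) (S + Pi.single k 1) • Lau.flip k (g (S + Pi.single k 1))
  map_add' g g' := by funext S; simp
  map_smul' r g := by funext S; simp [smul_comm]

theorem opC_apply (k : Fin n) (g : Nor n) (S : Fin n → ZMod 2) :
    opC k g S = sgn (k + 1) (S + Pi.single k 1) • Lau.flip k (g (S + Pi.single k 1)) := rfl

theorem opC_mul_opL (k : Fin n) (f : Lau n) : opC k * opL f = opL (Lau.flip k f) * opC k := by
  refine LinearMap.ext fun g => funext fun S => ?_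
  simp [opC_apply, opL_apply, mul_left_comm]

theorem op_rel (n : ℕ) :
    CliffordLaurent (opC (n := n)) (fun k => opL (Lau.x k)) (fun k => opL (Lau.y k)) where
  c_sq k := by
    refine LinearMap.ext fun g => funext fun S => ?_
    simp only [Module.End.mul_apply, opC_apply, map_zsmul, add_single_add_single, Lau.flip_flip,
      smul_smul, sgn_add, sgn_single, Nat.lt_succ_self, if_true, LinearMap.neg_apply,
      Module.End.one_apply, Pi.neg_apply]
    rw [mul_assoc, mul_left_comm, sgn_mul_self]
    simp
  c_anti {k l} h := by
    refine LinearMap.ext fun g => funext fun S => ?_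
    have e : S + Pi.single l 1 + Pi.single k 1 = S + Pi.single k 1 + Pi.single l 1 := by
      rw [add_right_comm]
    simp only [Module.End.mul_apply, opC_apply, map_zsmul, e, smul_smul, LinearMap.neg_apply,
      Pi.neg_apply, Lau.flip_comm k l]
    rw [← neg_smul]
    congr 1
    simp only [sgn_add, sgn_single, Nat.lt_succ_self, if_true]
    have : (k : ℕ) ≠ l := fun e => h (Fin.ext e.symm)
    rcases this.lt_or_gt with h | h
    · rw [if_pos (by omega), if_neg (by omega)]; ring
    · rw [if_neg (by omega), if_pos (by omega)]; ring
  xy k := by rw [← map_mul, Lau.x_mul_y, map_one]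
  yx k := by rw [← map_mul, mul_comm, Lau.x_mul_y, map_one]
  xx k l := by rw [← map_mul, mul_comm, map_mul]
  cx_same k := by rw [opC_mul_opL, Lau.flip_x_self]
  cx_far h := by rw [opC_mul_opL, Lau.flip_x_of_ne h]

/-- The representation of `CL n` on `Nor n`. -/
def nor (n : ℕ) : CL n →ₐ[Cq] Module.End Cq (Nor n) := lift (op_rel n)

/-- Laurent polynomials as elements of `CL n`. -/
def ofLau (n : ℕ) : Lau n →ₐ[Cq] CL n :=
  Lau.eval (fun i => (rel n).unit i) fun i j => (rel n).xx i j

@[simp] theorem ofLau_x (i : Fin n) : ofLau n (Lau.x i) = x i := Lau.eval_x _ _ i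

@[simp] theorem ofLau_y (i : Fin n) : ofLau n (Lau.y i) = y i := Lau.eval_y _ _ i

theorem nor_ofLau (f : Lau n) : nor n (ofLau n f) = opL f := by
  induction f using Lau.induction with
  | hr r => simp only [AlgHom.commutes]
  | hx i => simp [nor]
  | hy i => simp [nor]
  | hadd a b ha hb => simp [ha, hb]
  | hmul a b ha hb => simp [ha, hb]

theorem c_mul_ofLau (k : Fin n) (f : Lau n) :
    c k * ofLau n f = ofLau n (Lau.flip k f) * c k := by
  have h := rel n
  induction f using Lau.induction with
  | hr r => simp only [AlgHom.commutes, AlgEquiv.commutes, Algebra.commutes]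
  | hx i =>
    by_cases hi : i = k
    · subst hi; simp [h.cx_same]
    · simp [Lau.flip_x_of_ne hi, h.cx_far hi]
  | hy i =>
    by_cases hi : i = k
    · subst hi; simp [h.cy_same]
    · simp [Lau.flip_y_of_ne hi, h.cy_far hi]
  | hadd a b ha hb => simp [mul_add, add_mul, ha, hb]
  | hmul a b ha hb => rw [map_mul, map_mul, map_mul, ← mul_assoc, ha, mul_assoc, hb, mul_assoc]

theorem s_ofLau (k : Fin (n - 1)) (f : Lau n) :
    s k (ofLau n f) = ofLau n (Lau.perm (adj k) f) := by
  induction f using Lau.induction with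
  | hr r => simp only [AlgHom.commutes, AlgEquiv.commutes, s_algebraMap]
  | hx i => simp [s_x, adj]
  | hy i => simp [s_y, adj]
  | hadd a b ha hb => simp [ha, hb]
  | hmul a b ha hb => simp [s_mul, ha, hb]

/-- The product of the first `m` factors of the Clifford monomial with exponents `S`. -/
def cmonPart (S : Fin n → ZMod 2) : ℕ → CL n
  | 0 => 1
  | m + 1 => cmonPart S m * if h : m < n then (if S ⟨m, h⟩ = 0 then 1 else c ⟨m, h⟩) else 1

/-- The Clifford monomial with exponents `S`. -/
def cmon (S : Fin n → ZMod 2) : CL n := cmonPart S n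

theorem cmonPart_succ (S : Fin n → ZMod 2) {m : ℕ} (h : m < n) :
    cmonPart S (m + 1) = cmonPart S m * if S ⟨m, h⟩ = 0 then 1 else c ⟨m, h⟩ := by
  rw [cmonPart, dif_pos h]

theorem cmonPart_add_single (S : Fin n → ZMod 2) (k : Fin n) {m : ℕ} (h : m ≤ k) :
    cmonPart (S + Pi.single k 1) m = cmonPart S m := by
  induction m with
  | zero => rfl
  | succ m ih =>
    have hm : m < n := by omega
    have : (⟨m, hm⟩ : Fin n) ≠ k := fun e => by simp [← e] at h
    rw [cmonPart_succ _ hm, cmonPart_succ _ hm, ih (by omega)]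
    simp [this]

theorem c_mul_cmonPart_of_le (k : Fin n) (S : Fin n → ZMod 2) {m : ℕ} (h : m ≤ k) :
    c k * cmonPart S m = sgn m S • (cmonPart S m * c k) := by
  induction m with
  | zero => simp [cmonPart, sgn]
  | succ m ih =>
    have hm : m < n := by omega
    have hne : (⟨m, hm⟩ : Fin n) ≠ k := fun e => by simp [← e] at h
    rw [cmonPart_succ _ hm, sgn_succ _ hm, ← mul_assoc, ih (by omega), smul_mul_assoc, mul_assoc,
      mul_assoc, mul_smul]
    congr 1
    by_cases h0 : S ⟨m, hm⟩ = 0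
    · simp [h0, chi]
    · simp [h0, chi, (rel n).c_anti hne]

theorem c_mul_cmonPart (k : Fin n) (S : Fin n → ZMod 2) {m : ℕ} (h : (k : ℕ) < m) (hm : m ≤ n) :
    c k * cmonPart S m = sgn (k + 1) S • cmonPart (S + Pi.single k 1) m := by
  induction m with
  | zero => omega
  | succ m ih =>
    have hm' : m < n := by omega
    rw [cmonPart_succ _ hm', cmonPart_succ _ hm']
    rcases (Nat.lt_succ_iff.1 h).lt_or_eq with h | h
    · have hne : (⟨m, hm'⟩ : Fin n) ≠ k := fun e => by simp [← e] at h
      rw [← mul_assoc, ih h (by omega), smul_mul_assoc]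
      simp [hne]
    · obtain rfl : k = ⟨m, hm'⟩ := Fin.ext h
      rw [← mul_assoc, c_mul_cmonPart_of_le _ _ le_rfl, cmonPart_add_single _ _ le_rfl,
        smul_mul_assoc, sgn_succ _ hm', mul_smul]
      congr 1
      have h01 : ∀ z : ZMod 2, z = 0 ∨ z = 1 := by decide
      have h11 : (1 : ZMod 2) + 1 = 0 := by decide
      rcases h01 (S ⟨m, hm'⟩) with h0 | h0
      · simp [h0, chi]
      · simp [h0, chi, h11, mul_assoc, (rel n).c_sq]

theorem c_mul_cmon (k : Fin n) (S : Fin n → ZMod 2) :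
    c k * cmon S = sgn (k + 1) S • cmon (S + Pi.single k 1) :=
  c_mul_cmonPart k S k.2 le_rfl

theorem cmon_zero : cmon (0 : Fin n → ZMod 2) = 1 := by
  have : ∀ m, cmonPart (0 : Fin n → ZMod 2) m = 1 := by
    intro m
    induction m with
    | zero => rfl
    | succ m ih => simp [cmonPart, ih]
  exact this n

/-- The inverse of the map `a ↦ a v` from `CL n` to `Nor n`, with `v` the cyclic vector. -/
def ofNor (g : Nor n) : CL n := ∑ S, ofLau n (g S) * cmon S

theorem ofNor_nor (a : CL n) (g : Nor n) : ofNor (nor n a g) = a * ofNor g := by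
  have hL : ∀ (f : Lau n) (g : Nor n), ofNor (nor n (ofLau n f) g) = ofLau n f * ofNor g := by
    intro f g
    simp [ofNor, nor_ofLau, opL_apply, Finset.mul_sum, mul_assoc]
  induction a using CL.induction generalizing g with
  | hr r => simpa only [AlgHom.commutes] using hL (algebraMap Cq _ r) g
  | hc k =>
    have e : nor n (c k) = opC k := lift_c _ k
    rw [e, ofNor, ofNor, Finset.mul_sum]
    simp only [opC_apply, map_zsmul]
    rw [← Equiv.sum_comp (Equiv.addRight (Pi.single k 1))]
    refine Finset.sum_congr rfl fun S _ => ?_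
    simp only [Equiv.coe_addRight, add_single_add_single]
    rw [← mul_assoc, c_mul_ofLau, mul_assoc, c_mul_cmon, mul_smul_comm, smul_mul_assoc]
  | hx k => simpa using hL (Lau.x k) g
  | hy k => simpa using hL (Lau.y k) g
  | hadd a b ha hb =>
    rw [map_add, add_mul, ← ha, ← hb]
    simp [ofNor, add_mul, Finset.sum_add_distrib]
  | hmul a b ha hb => rw [map_mul, Module.End.mul_apply, ha, hb, mul_assoc]

/-- The cyclic vector of `Nor n`. -/
def vac (n : ℕ) : Nor n := Pi.single 0 1

theorem ofNor_single (S : Fin n → ZMod 2) (f : Lau n) :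
    ofNor (Pi.single S f) = ofLau n f * cmon S := by
  rw [ofNor, Finset.sum_eq_single S]
  · simp
  · intro S' _ h
    simp [Pi.single_eq_of_ne h]
  · simp

theorem ofNor_nor_vac (a : CL n) : ofNor (nor n a (vac n)) = a := by
  rw [ofNor_nor, vac, ofNor_single, map_one, cmon_zero, mul_one, mul_one]

theorem nor_ofLau_vac (f : Lau n) : nor n (ofLau n f) (vac n) = Pi.single 0 f := by
  rw [nor_ofLau]
  funext S
  rw [opL_apply, vac]
  by_cases h : S = 0
  · subst h; simp
  · simp [Pi.single_eq_of_ne h]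

theorem ofLau_injective : Function.Injective (ofLau n) := by
  intro f g h
  have := nor_ofLau_vac f
  rw [h, nor_ofLau_vac] at this
  exact (Pi.single_injective _ this).symm

/-- Right multiplication by `X_j` in the coordinates of `Nor n`. -/
def opR (j : Fin n) : Module.End Cq (Nor n) where
  toFun g S := Lau.mon (chi (S j) • Pi.single j 1) * g S
  map_add' g g' := by funext S; simp [mul_add]
  map_smul' r g := by funext S; simp

theorem opR_apply (j : Fin n) (g : Nor n) (S : Fin n → ZMod 2) :
    opR j g S = Lau.mon (chi (S j) • Pi.single j 1) * g S := rfl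

theorem opR_comm (j : Fin n) (a : CL n) : Commute (opR j) (nor n a) := by
  have hL : ∀ f : Lau n, Commute (opR j) (opL f) := fun f =>
    LinearMap.ext fun g => funext fun S => by
      simp [opR_apply, opL_apply, mul_left_comm]
  induction a using CL.induction with
  | hr r => simpa using (Algebra.commute_algebraMap_right r (opR j))
  | hc k =>
    have e : nor n (c k) = opC k := lift_c _ k
    rw [e]
    refine LinearMap.ext fun g => funext fun S => ?_
    simp only [Module.End.mul_apply, opR_apply, opC_apply, map_mul, Lau.flip_mon, mul_smul_comm]
    congr 3
    rw [map_zsmul, Pi.add_apply, chi_add]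
    by_cases h : j = k
    · subst h
      rw [Lau.flipExp_single_self]
      simp [chi]
    · rw [Lau.flipExp_single_of_ne h]
      simp [h, chi]
  | hx k => simpa [nor] using hL (Lau.x k)
  | hy k => simpa [nor] using hL (Lau.y k)
  | hadd a b ha hb => rw [map_add]; exact ha.add_right hb
  | hmul a b ha hb => rw [map_mul]; exact ha.mul_right hb

theorem nor_mul_x_vac (a : CL n) (j : Fin n) :
    nor n (a * x j) (vac n) = opR j (nor n a (vac n)) := by
  have e : nor n (x j) (vac n) = opR j (vac n) := by
    rw [← ofLau_x, nor_ofLau_vac]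
    funext S
    rw [opR_apply, vac]
    by_cases h : S = 0
    · subst h; simp [chi, Lau.x]
    · simp [Pi.single_eq_of_ne h]
  rw [map_mul, Module.End.mul_apply, e, ← Module.End.mul_apply, ← Module.End.mul_apply,
    (opR_comm j a).eq]

/-- If `a ∈ CL n` intertwines each `X_i` with `X_{w(i)}`, then only one of the coordinates of `a` can
be nonzero, and only if `w = 1`. -/
theorem eq_one_of_coord_ne_zero {a : CL n} {w : Equiv.Perm (Fin n)} (h : ∀ i, x i * a = a * x (w i))
    (S : Fin n → ZMod 2) (hS : nor n a (vac n) S ≠ 0) : w = 1 ∧ S = 0 := by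
  have key : ∀ i, w i = i ∧ S i = 0 := by
    intro i
    have e := congrArg (fun z => nor n z (vac n) S) (h i)
    simp only [nor_mul_x_vac, opR_apply] at e
    rw [← ofLau_x, map_mul, nor_ofLau, Module.End.mul_apply, opL_apply] at e
    have e' := Lau.mon_injective (mul_right_cancel₀ hS e)
    have hwi : w i = i := by
      by_contra hne
      have := congrFun e' i
      simp [Pi.single_eq_of_ne (Ne.symm hne)] at this
    have := congrFun e' i
    refine ⟨hwi, ?_⟩
    by_contra h0
    simp [hwi, chi, h0] at this
  exact ⟨Equiv.ext fun i => (key i).1, funext fun i => (key i).2⟩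

theorem eq_zero_of_intertwines {a : CL n} {w : Equiv.Perm (Fin n)} (hw : w ≠ 1)
    (h : ∀ i, x i * a = a * x (w i)) : a = 0 := by
  have e : nor n a (vac n) = 0 := by
    funext S
    by_contra hS
    exact hw (eq_one_of_coord_ne_zero h S hS).1
  rw [← ofNor_nor_vac a, e]
  simp [ofNor]

theorem eq_ofLau_of_commute {a : CL n} (h : ∀ i, x i * a = a * x i) :
    a = ofLau n (nor n a (vac n) 0) := by
  have e : nor n a (vac n) = Pi.single 0 (nor n a (vac n) 0) := by
    funext S
    by_cases h0 : S = 0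
    · subst h0; simp
    · rw [Pi.single_eq_of_ne h0]
      by_contra hS
      exact h0 (eq_one_of_coord_ne_zero (w := 1) h S hS).2
  conv_lhs => rw [← ofNor_nor_vac a, e, ofNor_single, cmon_zero, mul_one]

end CL

/-! ### The commutant of the Laurent polynomials -/

/-- Up to terms supported on elements shorter than `w`, the element `T_w X_i` is `X_{w(i)} T_w`. -/
theorem Reg.ρ_T_x (w v : Equiv.Perm (Fin n)) (i : Fin n) (h : len w ≤ len v) :
    ρ n (T w) (ofCL n (CL.x i) (e n)) v = if v = w then CL.x (w i) else 0 := by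
  induction w using perm_induction generalizing v with
  | h₁ =>
    by_cases hv : v = 1
    · subst hv; simp [T, ofCL_apply, e]
    · simp [T, ofCL_apply, e, hv]
  | h k w hk ih =>
    have hlen := len_of_desc hk
    have hv := len_adj_mul_le k (adj k * v)
    rw [adj_mul_adj_mul] at hv
    have hne : v ≠ adj k * w := by rintro rfl; omega
    have hiff : adj k * v = adj k * w ↔ v = w := mul_right_inj _
    rw [T_of_desc hk, map_mul, Module.End.mul_apply, ρ_t, t_apply, ih v (by omega),
      ih (adj k * v) (by omega), if_neg hne]
    by_cases hvw : v = w
    · subst hvw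
      have e : Equiv.swap (lo k) (hi k) (adj k (v i)) = v i := Equiv.swap_apply_self _ _ _
      simp [CL.s_x, e]
    · simp [hiff, hvw]

namespace Se

/-- Laurent polynomials as elements of `Se_n(q)`. -/
def ofLau (n : ℕ) : Lau n →ₐ[Cq] Se n := (ofCL n).comp (CL.ofLau n)

theorem ofLau_x (i : Fin n) : ofLau n (Lau.x i) = gen (.X i) := by simp [ofLau]

theorem ofLau_y (i : Fin n) : ofLau n (Lau.y i) = gen (.Xinv i) := by simp [ofLau]

theorem ofLau_injective : Function.Injective (ofLau n) :=
  ofCL_injective.comp CL.ofLau_injective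

theorem range_ofLau (n : ℕ) : (ofLau n).range = laurent n := by
  apply le_antisymm
  · rintro _ ⟨f, rfl⟩
    change ofLau n f ∈ laurent n
    induction f using Lau.induction with
    | hr r => rw [AlgHom.commutes]; exact (laurent n).algebraMap_mem r
    | hx i => rw [ofLau_x]; exact Algebra.subset_adjoin ⟨i, .inl rfl⟩
    | hy i => rw [ofLau_y]; exact Algebra.subset_adjoin ⟨i, .inr rfl⟩
    | hadd a b ha hb => rw [map_add]; exact add_mem ha hb
    | hmul a b ha hb => rw [map_mul]; exact mul_mem ha hb
  · refine Algebra.adjoin_le ?_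
    rintro _ ⟨i, rfl | rfl⟩
    · exact ⟨Lau.x i, ofLau_x i⟩
    · exact ⟨Lau.y i, ofLau_y i⟩

open Reg in
/-- An element of `Se_n(q)` that commutes with all `X_i` does not involve the `T_w` with `w ≠ 1`: if
`w` had maximal length among those, then its coefficient would intertwine each `X_i` with
`X_{w(i)}`, which is impossible. -/
theorem mem_range_ofCL_of_commute {z : Se n} (h : ∀ i, gen (.X i) * z = z * gen (.X i)) :
    ∃ a, z = ofCL n a := by
  classical
  set m := ρ n z (e n) with hm
  have hz : z = toSe m := (toSe_ρ_e z).symm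
  have h0 : ∀ w, w ≠ 1 → m w = 0 := by
    by_contra! hex
    obtain ⟨w₀, hw₀⟩ := hex
    -- Compare coefficients at an element `w ≠ 1` of maximal length in the support of `z`.
    obtain ⟨w, hw, hmax⟩ := Finset.exists_max_image
      (Finset.univ.filter fun w => w ≠ 1 ∧ m w ≠ 0) len ⟨w₀, by simpa using hw₀⟩
    simp only [Finset.mem_filter, Finset.mem_univ, true_and] at hw hmax
    refine hw.2 (CL.eq_zero_of_intertwines hw.1 fun i => ?_)
    have e₁ : ρ n (gen (.X i) * z) (e n) w = CL.x i * m w := by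
      rw [← ofCL_x, map_mul, Module.End.mul_apply, ρ_ofCL, ofCL_apply, hm]
    have e₂ : ρ n (z * gen (.X i)) (e n) w = m w * CL.x (w i) := by
      rw [← ofCL_x, map_mul, Module.End.mul_apply, ρ_ofCL, hz, toSe, map_sum,
        LinearMap.sum_apply, Finset.sum_apply, Finset.sum_eq_single w]
      · rw [map_mul, Module.End.mul_apply, ρ_ofCL, Reg.ofCL_apply, ρ_T_x w w i le_rfl, if_pos rfl]
      · intro u _ hu
        rw [map_mul, Module.End.mul_apply, ρ_ofCL, Reg.ofCL_apply]
        by_cases hmu : m u = 0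
        · rw [hmu, zero_mul]
        have hlen : len u ≤ len w := by
          by_cases hu1 : u = 1
          · rw [hu1, len_one]; exact Nat.zero_le _
          · exact hmax u ⟨hu1, hmu⟩
        rw [ρ_T_x u w i hlen, if_neg hu.symm, mul_zero]
      · simp
    rw [← e₁, ← e₂, h i]
  refine ⟨m 1, ?_⟩
  rw [hz, toSe, Finset.sum_eq_single 1]
  · simp [T]
  · intro w _ hw
    simp [h0 w hw]
  · simp

/-- An element of `Se_n(q)` that commutes with all `X_i` is a Laurent polynomial. -/
theorem mem_range_ofLau_of_commute {z : Se n} (h : ∀ i, gen (.X i) * z = z * gen (.X i)) :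
    ∃ f, z = ofLau n f := by
  obtain ⟨a, rfl⟩ := mem_range_ofCL_of_commute h
  refine ⟨CL.nor n a (CL.vac n) 0, congrArg (ofCL n) (CL.eq_ofLau_of_commute fun i => ?_)⟩
  apply ofCL_injective
  simpa using h i

end Se

theorem laurent_maximal (n : ℕ) : IsMaximalCommutative (laurent n) := by
  refine ⟨fun a ha b hb => ?_, fun B hB hle b hb => ?_⟩
  · exact congrArg Subtype.val (mul_comm (⟨a, ha⟩ : laurent n) ⟨b, hb⟩)
  · rw [← Se.range_ofLau]
    obtain ⟨f, hf⟩ := Se.mem_range_ofLau_of_commute (z := b) fun i =>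
      hB _ (hle (Algebra.subset_adjoin ⟨i, .inl rfl⟩)) _ hb
    exact ⟨f, hf.symm⟩

/-! ### Laurent polynomials invariant under the hyperoctahedral group -/

namespace Lau

/-- Evaluation of polynomials at the `X_i + X_i⁻¹`. -/
def evalSum (n : ℕ) : MvPolynomial (Fin n) Cq →ₐ[Cq] Lau n :=
  MvPolynomial.aeval fun i => x i + y i

theorem evalSum_X (i : Fin n) : evalSum n (MvPolynomial.X i) = x i + y i :=
  MvPolynomial.aeval_X _ i

theorem pow_add_pow_mem (i : Fin n) (m : ℕ) : x i ^ m + y i ^ m ∈ (evalSum n).range := by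
  have h1 : x i + y i ∈ (evalSum n).range := ⟨MvPolynomial.X i, evalSum_X i⟩
  induction m using Nat.strong_induction_on with
  | _ m ih =>
    match m with
    | 0 => exact add_mem (by simp [one_mem]) (by simp [one_mem])
    | 1 => simpa using h1
    | m + 2 =>
      have e : x i ^ (m + 2) + y i ^ (m + 2) =
          (x i + y i) * (x i ^ (m + 1) + y i ^ (m + 1)) - (x i ^ m + y i ^ m) := by
        linear_combination (-(x i ^ m + y i ^ m)) * x_mul_y i
      rw [e]
      exact sub_mem (mul_mem h1 (ih _ (by omega))) (ih _ (by omega))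

theorem mon_single_add_mem (i : Fin n) (m : ℤ) :
    mon (Pi.single i m) + mon (-Pi.single i m) ∈ (evalSum n).range := by
  have hx : ∀ m : ℕ, mon (Pi.single i (m : ℤ)) = x i ^ m := fun m => by
    rw [x, ← mon_nsmul, ← Pi.single_smul]; simp
  have hy : ∀ m : ℕ, mon (-Pi.single i (m : ℤ)) = y i ^ m := fun m => by
    rw [y, ← mon_nsmul, smul_neg, ← Pi.single_smul]; simp
  obtain ⟨m, rfl | rfl⟩ := Int.eq_nat_or_neg m
  · rw [hx, hy]; exact pow_add_pow_mem i m
  · rw [Pi.single_neg, neg_neg, hx, hy, add_comm]; exact pow_add_pow_mem i m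

/-- The action of sign vectors on exponents. -/
def signExp (p : Fin n → ℤˣ) : (Fin n → ℤ) ≃+ (Fin n → ℤ) where
  toFun a i := (p i : ℤ) * a i
  invFun a i := (p i : ℤ) * a i
  left_inv a := by funext i; simp [← mul_assoc, ← Units.val_mul]
  right_inv a := by funext i; simp [← mul_assoc, ← Units.val_mul]
  map_add' a b := by funext i; simp [mul_add]

/-- The automorphism of the algebra of Laurent polynomials that inverts the `X_i` with sign `-1`. -/
def sign (p : Fin n → ℤˣ) : Lau n ≃ₐ[Cq] Lau n := AddMonoidAlgebra.domCongr Cq Cq (signExp p)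

theorem sign_mon (p : Fin n → ℤˣ) (a : Fin n → ℤ) : sign p (mon a) = mon (signExp p a) := by
  simp [sign, mon]

theorem sign_mul (p p' : Fin n → ℤˣ) (f : Lau n) : sign (p * p') f = sign p (sign p' f) := by
  induction f using induction_mon with
  | hm a =>
    simp only [sign_mon]
    congr 1
    funext i
    simp [signExp, mul_assoc]
  | hadd f g hf hg => simp [hf, hg]
  | hsmul r f hf => simp [hf]

theorem sign_one (f : Lau n) : sign 1 f = f := by
  induction f using induction_mon with
  | hm a =>
    rw [sign_mon]
    congr 1
    funext i
    simp [signExp]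
  | hadd f g hf hg => simp [hf, hg]
  | hsmul r f hf => simp [hf]

theorem sign_mulSingle (k : Fin n) (f : Lau n) : sign (Pi.mulSingle k (-1)) f = flip k f := by
  induction f using induction_mon with
  | hm a =>
    rw [sign_mon, flip_mon]
    congr 1
    funext i
    by_cases h : i = k
    · subst h; simp [signExp, flipExp]
    · simp [signExp, flipExp, h]
  | hadd f g hf hg => simp [hf, hg]
  | hsmul r f hf => simp [hf]

theorem sign_eq_self {f : Lau n} (hf : ∀ k, flip k f = f) (p : Fin n → ℤˣ) : sign p f = f := by
  let S : Submonoid (Fin n → ℤˣ) :=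
    { carrier := {p | sign p f = f}
      one_mem' := sign_one f
      mul_mem' := fun {a b} ha hb => by
        have ha' : sign a f = f := ha
        have hb' : sign b f = f := hb
        show sign (a * b) f = f
        rw [sign_mul, hb', ha'] }
  have hp : p ∈ S := by
    rw [← Finset.univ_prod_mulSingle p]
    refine prod_mem fun i _ => ?_
    rcases Int.units_eq_one_or (p i) with h | h
    · rw [h, Pi.mulSingle_one]; exact one_mem S
    · rw [h]
      exact (sign_mulSingle i f).trans (hf i)
  exact hp

theorem sum_sign_mem (f : Lau n) : ∑ p : Fin n → ℤˣ, sign p f ∈ (evalSum n).range := by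
  induction f using induction_mon with
  | hm a =>
    have e : ∑ p : Fin n → ℤˣ, sign p (mon a) =
        ∏ i, ∑ u : ℤˣ, mon (Pi.single i ((u : ℤ) * a i)) := by
      rw [Finset.prod_univ_sum, Fintype.piFinset_univ]
      refine Finset.sum_congr rfl fun p _ => ?_
      rw [sign_mon, ← mon_sum]
      congr 1
      exact (Finset.univ_sum_single _).symm
    rw [e]
    refine prod_mem fun i _ => ?_
    have : ∑ u : ℤˣ, mon (Pi.single i ((u : ℤ) * a i)) =
        mon (Pi.single i (a i)) + mon (-Pi.single i (a i)) := by
      rw [UnitsInt.univ, Finset.sum_pair (by decide)]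
      simp [Pi.single_neg]
    rw [this]
    exact mon_single_add_mem i _
  | hadd f g hf hg =>
    simp only [map_add, Finset.sum_add_distrib]
    exact add_mem hf hg
  | hsmul r f hf =>
    simp only [map_smul, ← Finset.smul_sum]
    exact Subalgebra.smul_mem _ hf r

/-- Averaging over the sign changes shows that their invariants are polynomials in the
`X_i + X_i⁻¹`. -/
theorem mem_range_evalSum {f : Lau n} (hf : ∀ k, flip k f = f) : f ∈ (evalSum n).range := by
  have h := sum_sign_mem f
  simp only [sign_eq_self hf, Finset.sum_const, ← Nat.cast_smul_eq_nsmul Cq] at h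
  have hne : ((Finset.univ : Finset (Fin n → ℤˣ)).card : Cq) ≠ 0 :=
    Nat.cast_ne_zero.2 (Finset.card_ne_zero.2 Finset.univ_nonempty)
  have := Subalgebra.smul_mem _ h ((Finset.univ : Finset (Fin n → ℤˣ)).card : Cq)⁻¹
  rwa [smul_smul, inv_mul_cancel₀ hne, one_smul] at this

theorem evalSum_rename (w : Equiv.Perm (Fin n)) (p : MvPolynomial (Fin n) Cq) :
    evalSum n (MvPolynomial.rename w p) = perm w (evalSum n p) := by
  suffices h : (evalSum n).comp (MvPolynomial.rename w) = (perm w).toAlgHom.comp (evalSum n) from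
    DFunLike.congr_fun h p
  refine MvPolynomial.algHom_ext fun i => ?_
  simp [evalSum_X]

/-- The invariants of the hyperoctahedral group are the symmetric polynomials in the
`X_i + X_i⁻¹`. -/
theorem exists_symmetric {f : Lau n} (hf : ∀ k, flip k f = f) (hf' : ∀ w, perm w f = f) :
    ∃ p ∈ MvPolynomial.symmetricSubalgebra (Fin n) Cq, evalSum n p = f := by
  obtain ⟨p, hp⟩ := mem_range_evalSum hf
  have hp' : evalSum n p = f := hp
  have hne : ((Finset.univ : Finset (Equiv.Perm (Fin n))).card : Cq) ≠ 0 :=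
    Nat.cast_ne_zero.2 (Finset.card_ne_zero.2 Finset.univ_nonempty)
  refine ⟨((Finset.univ : Finset (Equiv.Perm (Fin n))).card : Cq)⁻¹ •
    ∑ w : Equiv.Perm (Fin n), MvPolynomial.rename w p, ?_, ?_⟩
  · refine Subalgebra.smul_mem _ ?_ _
    rw [MvPolynomial.mem_symmetricSubalgebra]
    intro v
    rw [map_sum, ← Equiv.sum_comp (Equiv.mulLeft v) fun w => MvPolynomial.rename w p]
    refine Finset.sum_congr rfl fun w _ => ?_
    rw [MvPolynomial.rename_rename]
    rfl
  · rw [map_smul, map_sum]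
    simp only [evalSum_rename, hp', hf', Finset.sum_const, ← Nat.cast_smul_eq_nsmul Cq, smul_smul,
      inv_mul_cancel₀ hne, one_smul]

end Lau

/-! ### The centre -/

namespace Se

theorem evalXaddInv_eq (p : MvPolynomial (Fin n) Cq) :
    evalXaddInv n p = ofLau n (Lau.evalSum n p) := by
  suffices h : evalXaddInv n = (ofLau n).comp (Lau.evalSum n) from DFunLike.congr_fun h p
  refine MvPolynomial.algHom_ext fun i => ?_
  simp only [evalXaddInv, AlgHom.comp_apply, MvPolynomial.aeval_X, Lau.evalSum_X, map_add, ofLau_x,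
    ofLau_y]
  rfl

theorem flip_eq_of_central {f : Lau n} (h : ∀ b, b * ofLau n f = ofLau n f * b) (k : Fin n) :
    Lau.flip k f = f := by
  have e : CL.c k * CL.ofLau n f = CL.ofLau n f * CL.c k := by
    apply ofCL_injective
    simpa [ofLau] using h (gen (.C k))
  rw [CL.c_mul_ofLau] at e
  have e' := congrArg (fun z => -(z * CL.c k)) e
  simp only [mul_assoc, (CL.rel n).c_sq, mul_neg, mul_one, neg_neg] at e'
  exact CL.ofLau_injective e'

theorem perm_adj_eq_of_central {f : Lau n} (h : ∀ b, b * ofLau n f = ofLau n f * b)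
    (k : Fin (n - 1)) : Lau.perm (adj k) f = f := by
  have e : t k * ofCL n (CL.ofLau n f) = ofCL n (CL.ofLau n f) * t k := h (t k)
  rw [t_mul_ofCL, CL.s_ofLau] at e
  have hd : Desc k (adj k) := by
    simpa using (desc_adj_mul k 1).2 (not_desc_one k)
  have ht : Reg.t k (Reg.e n) = Pi.single (adj k) 1 := by
    have := Reg.t_single k hd 1
    rw [adj_mul_adj, CL.s_one, CL.d_one, Pi.single_zero, add_zero] at this
    exact this
  have hne : adj k ≠ 1 := fun h1 => not_desc_one k (h1 ▸ hd)
  have h1 : Reg.e n (adj k) = 0 := Pi.single_eq_of_ne hne _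
  have e' := congrArg (fun z => Reg.ρ n z (Reg.e n) (adj k)) e
  simp only [map_add, map_mul, LinearMap.add_apply, Module.End.mul_apply, Reg.ρ_t, Reg.ρ_ofCL, ht,
    Pi.add_apply, Reg.ofCL_apply, Pi.single_eq_same, mul_one, h1, mul_zero, add_zero] at e'
  exact CL.ofLau_injective e'

theorem perm_eq_of_central {f : Lau n} (h : ∀ b, b * ofLau n f = ofLau n f * b)
    (w : Equiv.Perm (Fin n)) : Lau.perm w f = f := by
  have hmul : ∀ (v w : Equiv.Perm (Fin n)) (g : Lau n),
      Lau.perm (v * w) g = Lau.perm v (Lau.perm w g) := by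
    intro v w g
    induction g using Lau.induction_mon with
    | hm a =>
      simp only [Lau.perm_mon]
      rfl
    | hadd f g hf hg => simp [hf, hg]
    | hsmul r f hf => simp [hf]
  have hone : ∀ g : Lau n, Lau.perm 1 g = g := by
    intro g
    induction g using Lau.induction_mon with
    | hm a => rw [Lau.perm_mon]; rfl
    | hadd f g hf hg => simp [hf, hg]
    | hsmul r f hf => simp [hf]
  induction w using perm_induction with
  | h₁ => exact hone f
  | h k w hk ih =>
    rw [← adj_mul_adj_mul k w, hmul, ih, perm_adj_eq_of_central h]

/-- The correction term in moving `T_k` past `X_k + X_k⁻¹`. -/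
def corr (k : Fin (n - 1)) : Se n :=
  ε • (gen (.C (lo k)) * gen (.C (hi k)) * (gen (.X (lo k)) - gen (.X (hi k))) - gen (.X (hi k)) +
    gen (.Xinv (lo k)))

/-- The image of `X_i + X_i⁻¹` in `Se_n(q)`. -/
def xsum (i : Fin n) : Se n := gen (.X i) + gen (.Xinv i)

theorem evalXaddInv_X (i : Fin n) : evalXaddInv n (MvPolynomial.X i) = xsum i := by
  rw [evalXaddInv_eq, Lau.evalSum_X, map_add, ofLau_x, ofLau_y, xsum]

theorem c_comm_xsum (k i : Fin n) : Commute (gen (.C k)) (xsum i : Se n) := by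
  have h := rel n
  by_cases hi : i = k
  · subst hi
    change _ * _ = _ * _
    rw [xsum, mul_add, add_mul, h.cx_same, h.cy_same, add_comm]
  · exact Commute.add_right (h.cx_far hi) (h.cy_far hi)

theorem x_comm_xsum (k i : Fin n) : Commute (gen (.X k)) (xsum i : Se n) :=
  Commute.add_right ((rel n).xx k i) ((rel n).xy_comm k i)

theorem y_comm_xsum (k i : Fin n) : Commute (gen (.Xinv k)) (xsum i : Se n) :=
  Commute.add_right ((rel n).xy_comm i k).symm ((rel n).yy k i)

theorem comm_evalXaddInv {z : Se n} (h : ∀ i, Commute z (xsum i)) (p : MvPolynomial (Fin n) Cq) :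
    Commute z (evalXaddInv n p) := by
  induction p using MvPolynomial.induction_on with
  | C a =>
    rw [← MvPolynomial.algebraMap_eq, AlgHom.commutes]
    exact Algebra.commute_algebraMap_right a z
  | add p p' hp hp' => rw [map_add]; exact hp.add_right hp'
  | mul_X p i hp => rw [map_mul, evalXaddInv_X]; exact hp.mul_right (h i)

theorem corr_comm_xsum (k : Fin (n - 1)) (i : Fin n) : Commute (corr k) (xsum i) := by
  have hc := fun k => c_comm_xsum k i
  have hx := fun k => x_comm_xsum k i
  have hy := fun k => y_comm_xsum k i
  exact (((((hc _).mul_left (hc _)).mul_left ((hx _).sub_left (hx _))).sub_left (hx _)).add_left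
    (hy _)).smul_left ε

theorem t_mul_xsum_lo (k : Fin (n - 1)) :
    t k * xsum (lo k) = xsum (hi k) * t k + corr k := by
  have h := rel n
  have r := cross k
  have e : gen (.Xinv (hi k)) * gen (.C (lo k)) * gen (.C (hi k)) =
      gen (.C (lo k)) * gen (.C (hi k)) * (gen (.X (hi k)) : Se n) := by
    rw [mul_assoc (gen (.C (lo k))), h.cx_same, ← mul_assoc, h.cy_far (CL.lo_ne_hi k).symm]
  rw [xsum, xsum, corr, mul_add, add_mul, r.tx_lo, r.ty_lo h, e, mul_sub]
  simp only [smul_add, smul_sub]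
  abel

theorem t_mul_xsum_hi (k : Fin (n - 1)) :
    t k * xsum (hi k) = xsum (lo k) * t k - corr k := by
  have h := rel n
  have r := cross k
  have e : gen (.Xinv (lo k)) * (gen (.C (lo k)) * gen (.C (hi k))) =
      gen (.C (lo k)) * gen (.C (hi k)) * (gen (.X (lo k)) : Se n) := by
    rw [mul_assoc (gen (.C (lo k))), h.cx_far (CL.lo_ne_hi k), ← mul_assoc, ← mul_assoc, h.cx_same]
  rw [xsum, xsum, corr, mul_add, add_mul, r.tx_hi, r.ty_hi h, mul_add, e, mul_sub, add_mul,
    one_mul, mul_one]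
  simp only [smul_add, smul_sub]
  abel

/-- How `T_k` moves past a polynomial `p` in the `X_i + X_i⁻¹`: the correction involves the
divided difference of `p`. -/
theorem t_mul_evalXaddInv (k : Fin (n - 1)) (p : MvPolynomial (Fin n) Cq) :
    ∃ r, (MvPolynomial.X (lo k) - MvPolynomial.X (hi k)) * r = p - MvPolynomial.rename (adj k) p ∧
      t k * evalXaddInv n p =
        evalXaddInv n (MvPolynomial.rename (adj k) p) * t k + corr k * evalXaddInv n r := by
  induction p using MvPolynomial.induction_on with
  | C a =>
    refine ⟨0, by simp, ?_⟩
    rw [MvPolynomial.rename_C, ← MvPolynomial.algebraMap_eq, AlgHom.commutes, map_zero, mul_zero,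
      add_zero, Algebra.commutes]
  | add p p' hp hp' =>
    obtain ⟨r, hr, h⟩ := hp
    obtain ⟨r', hr', h'⟩ := hp'
    refine ⟨r + r', ?_, ?_⟩
    · rw [mul_add, hr, hr', map_add]; ring
    · simp only [map_add, mul_add, add_mul, h, h']; abel
  | mul_X p i hp =>
    obtain ⟨r, hr, h⟩ := hp
    obtain ⟨d, hd, hd'⟩ : ∃ d : MvPolynomial (Fin n) Cq,
        (MvPolynomial.X (lo k) - MvPolynomial.X (hi k)) * d =
          MvPolynomial.X i - MvPolynomial.X (adj k i) ∧
        t k * xsum i = xsum (adj k i) * t k + corr k * evalXaddInv n d := by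
      by_cases h₁ : i = lo k
      · exact ⟨1, by simp [h₁], by simp [h₁, t_mul_xsum_lo]⟩
      by_cases h₂ : i = hi k
      · refine ⟨-1, by simp [h₂], ?_⟩
        subst h₂
        rw [adj_hi, t_mul_xsum_hi, map_neg, map_one, sub_eq_add_neg]
        exact congrArg (_ + ·) (mul_neg_one (corr k)).symm
      · refine ⟨0, by simp [adj_of_ne h₁ h₂], ?_⟩
        rw [adj_of_ne h₁ h₂, map_zero, mul_zero, add_zero, xsum, mul_add, add_mul,
          (cross k).tx_far h₁ h₂, (cross k).ty_far (rel n) h₁ h₂]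
    refine ⟨MvPolynomial.rename (adj k) p * d + r * MvPolynomial.X i, ?_, ?_⟩
    · rw [map_mul, MvPolynomial.rename_X]
      linear_combination MvPolynomial.rename (adj k) p * hd + MvPolynomial.X i * hr
    · have hcomm := (comm_evalXaddInv (corr_comm_xsum k) (MvPolynomial.rename (adj k) p)).eq
      simp only [map_mul, map_add, MvPolynomial.rename_X, evalXaddInv_X]
      rw [← mul_assoc, h, add_mul, mul_assoc, hd']
      simp only [mul_add, ← mul_assoc, hcomm]
      abel

theorem t_comm_evalXaddInv (k : Fin (n - 1)) {p : MvPolynomial (Fin n) Cq} (hp : p.IsSymmetric) :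
    t k * evalXaddInv n p = evalXaddInv n p * t k := by
  obtain ⟨r, hr, h⟩ := t_mul_evalXaddInv k p
  rw [hp (adj k), sub_self] at hr
  have hne : (MvPolynomial.X (lo k) - MvPolynomial.X (hi k) : MvPolynomial (Fin n) Cq) ≠ 0 :=
    sub_ne_zero.2 ((MvPolynomial.X_injective).ne (CL.lo_ne_hi k))
  rw [h, hp (adj k), (mul_eq_zero.1 hr).resolve_left hne, map_zero, mul_zero, add_zero]

theorem center_eq (n : ℕ) :
    Subalgebra.center Cq (Se n) =
      (MvPolynomial.symmetricSubalgebra (Fin n) Cq).map (evalXaddInv n) := by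
  apply le_antisymm
  · intro z hz
    rw [Subalgebra.mem_center_iff] at hz
    obtain ⟨f, rfl⟩ := mem_range_ofLau_of_commute fun i => hz (gen (.X i))
    obtain ⟨p, hp, rfl⟩ := Lau.exists_symmetric (flip_eq_of_central hz) (perm_eq_of_central hz)
    exact ⟨p, hp, evalXaddInv_eq p⟩
  · rintro _ ⟨p, hp, rfl⟩
    change evalXaddInv n p ∈ _
    rw [Subalgebra.mem_center_iff]
    intro b
    induction b using Se.induction with
    | hr r => exact Algebra.commutes r _
    | hg g =>
      rcases g with k | k | k | k
      · exact t_comm_evalXaddInv k hp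
      · exact comm_evalXaddInv (c_comm_xsum k) p
      · exact comm_evalXaddInv (x_comm_xsum k) p
      · exact comm_evalXaddInv (y_comm_xsum k) p
    | hadd a b ha hb => rw [add_mul, mul_add, ha, hb]
    | hmul a b ha hb => rw [mul_assoc, hb, ← mul_assoc, ha, mul_assoc]

end Se

end AffineSergeev

end

theorem proposition3p2 (n : ℕ) (hn : 1 ≤ n) :
    AffineSergeev.IsMaximalCommutative (AffineSergeev.laurent n) ∧
    Subalgebra.center AffineSergeev.Cq (AffineSergeev.Se n) =
      (MvPolynomial.symmetricSubalgebra (Fin n) AffineSergeev.Cq).map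
        (AffineSergeev.evalXaddInv n) :=
  ⟨AffineSergeev.laurent_maximal n, AffineSergeev.Se.center_eq n⟩
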